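/- Let $d\in\{2,3\}$ and let $\Omega\subset\mathbb{R}^d$ be a bounded open set with a mesh $\mathcal{T}_h$: a finite family of pairwise disjoint, open, polytopal elements $K$ whose closures cover $\overline\Omega$, where each $\partial K$ is the union of finitely many flat faces (convex $(d-1)$-dimensional polytopes, with disjoint relative interiors) and the mesh conforms to $\Omega$: every face either lies in $\partial\Omega$ and belongs to exactly one element, or is an interior face, i.e. its relative interior does not meet $\partial\Omega$, and is shared by exactly two elements $K_+$ and $K_-$. Let $\mathcal{F}_h^i$ be the set of interior faces; for $F\in\mathcal{F}_h^i$ let $\boldsymbol{n}_F$ be the unit normal pointing from $K_+$ to $K_-$, and for a vector field $\boldsymbol{v}$ with one-sided traces $\boldsymbol{v}_\pm$ on $F$ from $K_\pm$ put $[\![\boldsymbol{v}]\!]=\boldsymbol{v}_+-\boldsymbol{v}_-$ and $\{\!\{\boldsymbol{v}\}\!\}=\frac12(\boldsymbol{v}_++\boldsymbol{v}_-)$. Let $\boldsymbol{H}_0(\mathrm{div};\Omega)=\{\boldsymbol{w}\in \boldsymbol{L}^2(\Omega):\nabla\cdot\boldsymbol{w}\in L^2(\Omega),\ \boldsymbol{w}\cdot\boldsymbol{n}|_{\partial\Omega}=0\}$,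 and let $\boldsymbol{W}_h$ be a linear subspace of $\boldsymbol{H}_0(\mathrm{div};\Omega)$ whose members are piecewise $C^1$ up to the boundaries of the elements, i.e. coincide on each $K\in\mathcal{T}_h$ with a $C^1$ field on $\mathbb{R}^d$ (for instance, piecewise polynomial fields). Let $\zeta\ge 0$. For $\boldsymbol{\beta}_h,\boldsymbol{v}_h,\boldsymbol{w}_h\in\boldsymbol{W}_h$ define $$c_h(\boldsymbol{\beta}_h;\boldsymbol{v}_h,\boldsymbol{w}_h)=\sum_{K\in\mathcal{T}_h}\int_K\Big((\boldsymbol{\beta}_h\cdot\nabla\boldsymbol{v}_h)\cdot\boldsymbol{w}_h+\tfrac12(\nabla\cdot\boldsymbol{\beta}_h)\,\boldsymbol{v}_h\cdot\boldsymbol{w}_h\Big)dV-\sum_{F\in\mathcal{F}_h^i}\int_F(\boldsymbol{\beta}_h\cdot\boldsymbol{n}_F)\,[\![\boldsymbol{v}_h]\!]\cdot\{\!\{\boldsymbol{w}_h\}\!\}\,dA+\zeta\sum_{F\in\mathcal{F}_h^i}\int_F|\boldsymbol{\beta}_h\cdot\boldsymbol{n}_F|\,[\![\boldsymbol{v}_h]\!]\cdot[\![\boldsymbol{w}_h]\!]\,dA,$$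 where $\boldsymbol{\beta}_h\cdot\boldsymbol{n}_F$ is taken from the side of $K_+$. Then for all $\boldsymbol{\beta}_h,\boldsymbol{w}_h\in\boldsymbol{W}_h$ $$c_h(\boldsymbol{\beta}_h;\boldsymbol{w}_h,\boldsymbol{w}_h)=\zeta\sum_{F\in\mathcal{F}_h^i}\int_F|\boldsymbol{\beta}_h\cdot\boldsymbol{n}_F|\,\big|[\![\boldsymbol{w}_h]\!]\big|^2\,dA=|\boldsymbol{w}_h|_{\boldsymbol{\beta}_h}^2,\qquad |\boldsymbol{w}_h|_{\boldsymbol{\beta}_h}:=\Big(\zeta\sum_{F\in\mathcal{F}_h^i}\int_F|\boldsymbol{\beta}_h\cdot\boldsymbol{n}_F|\,\big|[\![\boldsymbol{w}_h]\!]\big|^2\,dA\Big)^{1/2},$$ and for every $\boldsymbol{\beta}_h\in\boldsymbol{W}_h$ the map $\boldsymbol{w}_h\mapsto|\boldsymbol{w}_h|_{\boldsymbol{\beta}_h}$ is a seminorm on $\boldsymbol{W}_h$. -/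

import Mathlib

open MeasureTheory Filter Topology Set
open scoped RealInnerProductSpace

namespace MixedFE

/-- The ambient Euclidean space `ℝ^d`. -/
abbrev E (d : ℕ) : Type := EuclideanSpace ℝ (Fin d)

/-- A flat face: a convex polytope of dimension `d - 1` in `ℝ^d`. -/
def IsFlatFace {d : ℕ} (F : Set (E d)) : Prop :=
  (∃ s : Finset (E d), F = convexHull ℝ (s : Set (E d))) ∧
    Module.finrank ℝ (vectorSpan ℝ F) + 1 = d

/-- `n` is the unit normal on the flat face `F` pointing out of the open set `K`: it has length
one, is orthogonal to `F`, and at each relative interior point of `F` the set `K` lies on the side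
of `-n`, while the side of `n` lies outside `closure K`. -/
def IsOutwardNormal {d : ℕ} (K F : Set (E d)) (n : E d) : Prop :=
  ‖n‖ = 1 ∧ (∀ x ∈ F, ∀ y ∈ F, ⟪n, x - y⟫ = 0) ∧
    ∀ x ∈ intrinsicInterior ℝ F, ∀ᶠ t : ℝ in 𝓝[>] 0, x - t • n ∈ K ∧ x + t • n ∉ closure K

/-- A face is interior when its relative interior does not meet the boundary of `Ω`. -/
def IsInteriorFace {d : ℕ} (Ω F : Set (E d)) : Prop :=
  intrinsicInterior ℝ F ∩ frontier Ω = ∅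

/-- A mesh of `Ω` by open polytopal (not necessarily convex) elements with flat faces.  The faces
`F` of an element `K` are those faces of the mesh that lie in `∂K`.  Each face `F` carries a unit
normal `normal F`, pointing from the `+` side `plus F` to the `-` side `minus F` (out of the domain
if `F` is a boundary face; then `minus F` has no meaning). -/
structure Mesh (d : ℕ) (Ω : Set (E d)) where
  elements : Finset (Set (E d))
  faces : Finset (Set (E d))
  plus : Set (E d) → Set (E d)
  minus : Set (E d) → Set (E d)
  normal : Set (E d) → E d
  isOpen_element : ∀ K ∈ elements, IsOpen K
  nonempty_element : ∀ K ∈ elements, K.Nonempty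
  element_subset : ∀ K ∈ elements, K ⊆ Ω
  /-- elements do not overlap -/
  disjoint_elements : ∀ K ∈ elements, ∀ L ∈ elements, K ≠ L → Disjoint K L
  /-- the elements fill the domain -/
  cover : closure Ω = ⋃ K ∈ elements, closure K
  isFlatFace : ∀ F ∈ faces, IsFlatFace F
  /-- distinct faces do not overlap -/
  disjoint_faces : ∀ F ∈ faces, ∀ G ∈ faces, F ≠ G →
    Disjoint (intrinsicInterior ℝ F) (intrinsicInterior ℝ G)
  /-- the boundary of an element is composed of its faces -/
  frontier_element : ∀ K ∈ elements, 
    frontier K = ⋃ F ∈ {F : Set (E d) | F ∈ faces ∧ F ⊆ frontier K}, F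
  /-- the mesh conforms to the domain: a face that is not interior lies in the boundary -/
  boundary_face : ∀ F ∈ faces, ¬ IsInteriorFace Ω F → F ⊆ frontier Ω
  plus_mem : ∀ F ∈ faces, plus F ∈ elements ∧ F ⊆ frontier (plus F)
  minus_mem : ∀ F ∈ faces, IsInteriorFace Ω F →
    minus F ∈ elements ∧ minus F ≠ plus F ∧ F ⊆ frontier (minus F)
  /-- an interior face is shared by exactly two elements, a boundary face belongs to only one -/
  adjacent : ∀ F ∈ faces, ∀ K ∈ elements, F ⊆ frontier K →
    K = plus F ∨ (IsInteriorFace Ω F ∧ K = minus F)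
  normal_plus : ∀ F ∈ faces, IsOutwardNormal (plus F) F (normal F)
  normal_minus : ∀ F ∈ faces, IsInteriorFace Ω F → IsOutwardNormal (minus F) F (-normal F)

open Classical in
/-- The collection of interior faces of the mesh. -/
noncomputable def Mesh.interiorFaces {d : ℕ} {Ω : Set (E d)} (M : Mesh d Ω) :
    Finset (Set (E d)) :=
  M.faces.filter (IsInteriorFace Ω)

/-- `g` is the weak divergence of `w` on `Ω`. -/
def IsWeakDiv {d : ℕ} (Ω : Set (E d)) (w : E d → E d) (g : E d → ℝ) : Prop :=
  ∀ φ : E d → ℝ, ContDiff ℝ ((⊤ : ℕ∞) : WithTop ℕ∞) φ → HasCompactSupport φ → tsupport φ ⊆ Ω →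
    ∫ x in Ω, fderiv ℝ φ x (w x) = - ∫ x in Ω, g x * φ x

/-- The normal trace `w · n` of `w`, whose divergence is `g`, vanishes on `∂Ω`.  The normal trace is
the functional `φ ↦ ∫_Ω (w · ∇φ + g φ)`, where `φ` is not required to vanish on `∂Ω`. -/
def NormalTraceZero {d : ℕ} (Ω : Set (E d)) (w : E d → E d) (g : E d → ℝ) : Prop :=
  ∀ φ : E d → ℝ, ContDiff ℝ ((⊤ : ℕ∞) : WithTop ℕ∞) φ → HasCompactSupport φ →
    ∫ x in Ω, (fderiv ℝ φ x (w x) + g x * φ x) = 0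

/-- Membership in `H_0(div; Ω)`. -/
def MemH0Div {d : ℕ} (Ω : Set (E d)) (w : E d → E d) : Prop :=
  MemLp w 2 (volume.restrict Ω) ∧
    ∃ g : E d → ℝ, MemLp g 2 (volume.restrict Ω) ∧ IsWeakDiv Ω w g ∧ NormalTraceZero Ω w g

/-- `w` is piecewise `C¹`: on each element it is the restriction of a `C¹` field on `ℝ^d` (as is
every piecewise polynomial field). -/
def IsPiecewiseC1 {d : ℕ} {Ω : Set (E d)} (M : Mesh d Ω) (w : E d → E d) : Prop :=
  ∀ K ∈ M.elements, ∃ g : E d → E d, ContDiff ℝ 1 g ∧ EqOn w g K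

/-- The trace of `w` at a boundary point `x` of `K`, taken from inside `K`. -/
noncomputable def trace {d : ℕ} (K : Set (E d)) (w : E d → E d) (x : E d) : E d :=
  limUnder (𝓝[K] x) w

/-- The pointwise divergence. -/
noncomputable def divergence {d : ℕ} (w : E d → E d) (x : E d) : ℝ :=
  ∑ i : Fin d, (fderiv ℝ w x (EuclideanSpace.single i 1)) i

namespace Mesh

variable {d : ℕ} {Ω : Set (E d)}

/-- The jump `w₊ - w₋` on an interior face `F`. -/
noncomputable def jump (M : Mesh d Ω) (F : Set (E d)) (w : E d → E d) (x : E d) : E d :=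
  trace (M.plus F) w x - trace (M.minus F) w x

/-- The average `(w₊ + w₋) / 2` on an interior face `F`. -/
noncomputable def avg (M : Mesh d Ω) (F : Set (E d)) (w : E d → E d) (x : E d) : E d :=
  (1 / 2 : ℝ) • (trace (M.plus F) w x + trace (M.minus F) w x)

/-- The normal component `β · n_F` on `F` (for fields in `H(div)` it is the same from both sides of
an interior face). -/
noncomputable def normalComp (M : Mesh d Ω) (F : Set (E d)) (β : E d → E d) (x : E d) : ℝ :=
  ⟪trace (M.plus F) β x, M.normal F⟫

/-- `∑_F ∫_F |β · n_F| [[v]] · [[w]] dA`, over the interior faces. -/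
noncomputable def upwind (M : Mesh d Ω) (β v w : E d → E d) : ℝ :=
  ∑ F ∈ M.interiorFaces,
    ∫ x in F, |M.normalComp F β x| * ⟪M.jump F v x, M.jump F w x⟫
      ∂(Measure.euclideanHausdorffMeasure (d - 1))

/-- The convective trilinear form
`c_h(β; v, w) = (β · ∇_h v, w) + ½ ((∇ · β) v, w) - ⟨(β · n_F) [[v]], {{w}}⟩ + ζ ⟨|β · n_F| [[v]], [[w]]⟩`,
with the volume terms summed over the elements and the face terms over the interior faces. -/
noncomputable def convForm (M : Mesh d Ω) (ζ : ℝ) (β v w : E d → E d) : ℝ :=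
  (∑ K ∈ M.elements, ∫ x in K, ⟪fderiv ℝ v x (β x), w x⟫)
    + (1 / 2) * (∑ K ∈ M.elements, ∫ x in K, ⟪divergence β x • v x, w x⟫)
    - (∑ F ∈ M.interiorFaces,
        ∫ x in F, ⟪M.normalComp F β x • M.jump F v x, M.avg F w x⟫
          ∂(Measure.euclideanHausdorffMeasure (d - 1)))
    + ζ * M.upwind β v w

/-- `|w|_β = (ζ ∑_F ∫_F |β · n_F| |[[w]]|² dA)^{1/2}`. -/
noncomputable def convSeminorm (M : Mesh d Ω) (ζ : ℝ) (β w : E d → E d) : ℝ :=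
  Real.sqrt (ζ * M.upwind β w w)

end Mesh

end MixedFE

/-! On an element the volume integrand with both arguments equal to `w` is half the divergence of
`|w|² β`, so the divergence theorem turns the volume terms into `½ ∫ |w|² β·n` over the faces of the
elements. For `β` in `H_0(div)` the normal component is single-valued on interior faces and zero on
boundary faces. An interior face therefore contributes `½ (β·n)(|w₊|² - |w₋|²) = (β·n) [[w]]·{{w}}`,
exactly what the consistency term subtracts, and only the upwind term survives
(`Mesh.convForm_self`). That term is a positive semidefinite symmetric bilinear form in `(v, w)`, so
the square root of its diagonal is a seminorm.

Two ingredients carry the argument. The divergence theorem on elements that need not be convex comes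
from counting crossings: along a generic line in direction `e`, the indicator of `K` is the signed
sum of the indicators of the half-infinite cylinders ("shadows") behind the faces
(`IsPolytopal.indicator_eq_sum_shadow`). On one such cylinder, Fubini and the fundamental theorem of
calculus integrate a directional derivative (`integral_shadow`).

The behaviour of `β·n` on faces (`Mesh.ae_normal_jump_eq_zero`) comes from testing the zero normal
trace with functions that need not vanish on the boundary. First the weak divergence is identified
with the piecewise one; elementwise integration by parts then leaves only face integrals, and the
fundamental lemma of the calculus of variations applies to surface measure on the skeleton. -/

namespace MixedFE

/-! ### Slanted coordinates over a hyperplane and integration over shadows. -/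

section Cylinder

variable {d : ℕ}

/-- The time at which the line through `z` in direction `e` hits the hyperplane through `p` with
normal `n`. -/
noncomputable def hitTime (n p e z : E d) : ℝ := ⟪n, p - z⟫ / ⟪n, e⟫

/-- The point at which the line through `z` in direction `e` hits the hyperplane through `p` with
normal `n`. -/
noncomputable def hitPoint (n p e z : E d) : E d := z + hitTime n p e z • e

/-- The points `z` from which the set `F`, contained in the hyperplane through `p` with
normal `n`, is hit when moving in direction `e`. -/
def shadow (n p e : E d) (F : Set (E d)) : Set (E d) :=
  {z | 0 ≤ hitTime n p e z ∧ hitPoint n p e z ∈ F}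

theorem continuous_hitTime (n p e : E d) : Continuous (hitTime n p e) := by
  unfold hitTime; fun_prop

theorem continuous_hitPoint (n p e : E d) : Continuous (hitPoint n p e) := by
  have := continuous_hitTime n p e
  unfold hitPoint; fun_prop

theorem measurableSet_shadow (n p e : E d) {F : Set (E d)} (hF : MeasurableSet F) :
    MeasurableSet (shadow n p e F) :=
  (measurableSet_le measurable_const (continuous_hitTime n p e).measurable).inter
    ((continuous_hitPoint n p e).measurable hF)

theorem hitTime_add_smul {n p e x : E d} (hne : ⟪n, e⟫ ≠ 0) (hx : ⟪n, x - p⟫ = 0) (s : ℝ) :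
    hitTime n p e (x + s • e) = -s := by
  have : p - (x + s • e) = -(x - p) - s • e := by abel
  rw [hitTime, this, inner_sub_right, inner_neg_right, hx, inner_smul_right]
  field_simp
  simp

theorem hitPoint_add_smul {n p e x : E d} (hne : ⟪n, e⟫ ≠ 0) (hx : ⟪n, x - p⟫ = 0) (s : ℝ) :
    hitPoint n p e (x + s • e) = x := by
  rw [hitPoint, hitTime_add_smul hne hx]
  module

/-- The affine isometry of the orthogonal complement of `n` onto the hyperplane through `p`. -/
noncomputable def hyperplaneMap (n p : E d) : (ℝ ∙ n)ᗮ →ᵃⁱ[ℝ] E d :=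
  (AffineIsometryEquiv.vaddConst ℝ p).toAffineIsometry.comp (ℝ ∙ n)ᗮ.subtypeₗᵢ.toAffineIsometry

theorem hyperplaneMap_apply (n p : E d) (a : (ℝ ∙ n)ᗮ) : hyperplaneMap n p a = (a : E d) + p := rfl

theorem inner_hyperplaneMap_sub (n p : E d) (a : (ℝ ∙ n)ᗮ) : ⟪n, hyperplaneMap n p a - p⟫ = 0 := by
  rw [hyperplaneMap_apply, add_sub_cancel_right]
  exact Submodule.mem_orthogonal_singleton_iff_inner_right.1 a.2

theorem range_hyperplaneMap (n p : E d) : range (hyperplaneMap n p) = {x | ⟪n, x - p⟫ = 0} := by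
  ext x
  constructor
  · rintro ⟨a, rfl⟩
    exact inner_hyperplaneMap_sub n p a
  · intro hx
    exact ⟨⟨x - p, Submodule.mem_orthogonal_singleton_iff_inner_right.2 hx⟩, by
      simp [hyperplaneMap_apply]⟩

theorem image_preimage_hyperplaneMap {n p : E d} {F : Set (E d)}
    (hFH : ∀ x ∈ F, ⟪n, x - p⟫ = 0) : hyperplaneMap n p '' (hyperplaneMap n p ⁻¹' F) = F := by
  rw [image_preimage_eq_inter_range, range_hyperplaneMap]
  exact inter_eq_left.2 hFH

theorem finrank_orthogonal_unit {n : E d} (hn : ‖n‖ = 1) :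
    Module.finrank ℝ (ℝ ∙ n)ᗮ = d - 1 := by
  have h := (ℝ ∙ n).finrank_add_finrank_orthogonal
  rw [finrank_span_singleton (by rintro rfl; simp at hn)] at h
  simp at h
  omega

theorem map_hyperplaneMap {n : E d} (hn : ‖n‖ = 1) (p : E d) :
    Measure.map (hyperplaneMap n p) volume
      = (Measure.euclideanHausdorffMeasure (d - 1)).restrict {x | ⟪n, x - p⟫ = 0} := by
  rw [← range_hyperplaneMap, ← (hyperplaneMap n p).isometry.map_euclideanHausdorffMeasure,
    ← finrank_orthogonal_unit hn, InnerProductSpace.euclideanHausdorffMeasure_eq_volume]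

theorem measurableEmbedding_hyperplaneMap (n p : E d) :
    MeasurableEmbedding (hyperplaneMap n p) :=
  (hyperplaneMap n p).isometry.isClosedEmbedding.measurableEmbedding

theorem map_add_smul_unit {n : E d} (hn : ‖n‖ = 1) :
    Measure.map (fun q : (ℝ ∙ n)ᗮ × ℝ => (q.1 : E d) + q.2 • n) volume = volume := by
  have h1 := ((ℝ ∙ n).measurePreserving_measurableEquivProd (0 : E d)).symm
  have h2 : MeasurePreserving (Prod.map (LinearIsometryEquiv.toSpanUnitSingleton (𝕜 := ℝ) n hn) id)
      (volume : Measure (ℝ × (ℝ ∙ n)ᗮ)) volume :=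
    (LinearIsometryEquiv.toSpanUnitSingleton (𝕜 := ℝ) n hn).measurePreserving.prod
      (MeasurePreserving.id _)
  have h3 := (h1.comp h2).comp (Measure.measurePreserving_swap (μ := (volume : Measure (ℝ ∙ n)ᗮ))
    (ν := (volume : Measure ℝ)))
  have h4 := h3.map_eq
  rw [InnerProductSpace.euclideanHausdorffMeasure_eq_volume] at h4
  rw [← h4]
  congr 1
  ext1 q
  simp [add_comm]

/-- The slanted parametrization is the orthogonal one followed by the shear `x ↦ x + ⟪n, x⟫ (e -
n)`, of determinant `1 + ⟪n, e - n⟫ = ⟪n, e⟫`, and a translation. -/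
theorem map_hyperplaneMap_add_smul {n : E d} (hn : ‖n‖ = 1) (p : E d) {e : E d}
    (hne : ⟪n, e⟫ ≠ 0) :
    Measure.map (fun q : (ℝ ∙ n)ᗮ × ℝ => hyperplaneMap n p q.1 + q.2 • e) volume
      = ENNReal.ofReal |⟪n, e⟫⁻¹| • volume := by
  let T : E d →ₗ[ℝ] E d := LinearMap.transvection (innerₛₗ ℝ n) (e - n)
  have hdet : LinearMap.det T = ⟪n, e⟫ := by
    simp only [T, LinearMap.transvection.det, innerₛₗ_apply_apply, inner_sub_right,
      real_inner_self_eq_norm_sq, hn]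
    ring
  have hT := Measure.map_linearMap_addHaar_eq_smul_addHaar (volume : Measure (E d)) (f := T)
    (by rwa [hdet])
  rw [hdet] at hT
  have hTm : Measurable T := T.continuous_of_finiteDimensional.measurable
  have hadd : Measure.map (fun x : E d => x + p) volume = volume := map_add_right_eq_self _ _
  have h1 : (fun q : (ℝ ∙ n)ᗮ × ℝ => hyperplaneMap n p q.1 + q.2 • e)
      = (fun x => x + p) ∘ T ∘ (fun q : (ℝ ∙ n)ᗮ × ℝ => (q.1 : E d) + q.2 • n) := by
    ext1 q
    have hq : ⟪n, (q.1 : E d)⟫ = 0 := Submodule.mem_orthogonal_singleton_iff_inner_right.1 q.1.2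
    simp only [Function.comp_apply, hyperplaneMap_apply, T, LinearMap.transvection.apply,
      innerₛₗ_apply_apply, inner_add_right, hq, inner_smul_right, real_inner_self_eq_norm_sq, hn]
    module
  rw [h1, ← Measure.map_map (by fun_prop) (hTm.comp (by fun_prop)),
    ← Measure.map_map hTm (by fun_prop), map_add_smul_unit hn, hT, Measure.map_smul, hadd]

/-- In slanted coordinates the set is a null set times a line. Applied to relative boundaries of
faces, this makes almost every line avoid them. -/
theorem hitPoint_mem_null {n : E d} (hn : ‖n‖ = 1) {p e : E d} (hne : ⟪n, e⟫ ≠ 0)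
    {A : Set (E d)} (hA : MeasurableSet A)
    (h0 : Measure.euclideanHausdorffMeasure (d - 1) A = 0) :
    volume {z | hitPoint n p e z ∈ A} = 0 := by
  have hm : MeasurableSet {z | hitPoint n p e z ∈ A} :=
    (continuous_hitPoint n p e).measurable hA
  have hc : Measurable (fun q : (ℝ ∙ n)ᗮ × ℝ => hyperplaneMap n p q.1 + q.2 • e) := by
    have := (hyperplaneMap n p).continuous
    fun_prop
  have h1 := congrArg (fun μ => μ {z | hitPoint n p e z ∈ A}) (map_hyperplaneMap_add_smul hn p hne)
  simp only [Measure.smul_apply, Measure.map_apply hc hm] at h1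
  have h2 : (fun q : (ℝ ∙ n)ᗮ × ℝ => hyperplaneMap n p q.1 + q.2 • e) ⁻¹'
      {z | hitPoint n p e z ∈ A} = (hyperplaneMap n p ⁻¹' A) ×ˢ univ := by
    ext q
    simp [hitPoint_add_smul hne (inner_hyperplaneMap_sub n p q.1)]
  have h3 : volume (hyperplaneMap n p ⁻¹' A) = 0 := by
    rw [← (measurableEmbedding_hyperplaneMap n p).map_apply, map_hyperplaneMap hn]
    exact le_antisymm ((Measure.restrict_apply_le _ _).trans h0.le) bot_le
  rw [h2, Measure.volume_eq_prod, Measure.prod_prod, h3, zero_mul, eq_comm, smul_eq_mul,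
    mul_eq_zero] at h1
  refine h1.resolve_left ?_
  simpa using hne

theorem setIntegral_eq_integral_hyperplaneMap {n : E d} (hn : ‖n‖ = 1) {p : E d} {F : Set (E d)}
    (hF : MeasurableSet F) (hFH : ∀ x ∈ F, ⟪n, x - p⟫ = 0) (φ : E d → ℝ) :
    ∫ x in F, φ x ∂(Measure.euclideanHausdorffMeasure (d - 1))
      = ∫ a, F.indicator φ (hyperplaneMap n p a) := by
  rw [← (measurableEmbedding_hyperplaneMap n p).integral_map, map_hyperplaneMap hn,
    integral_indicator hF, Measure.restrict_restrict hF, inter_eq_left.2 (show F ⊆ {x | ⟪n, x - p⟫ = 0} from hFH)]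

/-- In slanted coordinates the shadow is `F × (-∞, 0]`. The inner integral of the derivative along
the line is the value of `φ` at the hit point, and the Jacobian supplies `|⟪n, e⟫|`. -/
theorem integral_shadow {n : E d} (hn : ‖n‖ = 1) {p e : E d} (hne : ⟪n, e⟫ ≠ 0) {F : Set (E d)}
    (hF : MeasurableSet F) (hFH : ∀ x ∈ F, ⟪n, x - p⟫ = 0) {φ : E d → ℝ} (hφ : ContDiff ℝ 1 φ)
    (hφc : HasCompactSupport φ) :
    ∫ z in shadow n p e F, fderiv ℝ φ z e
      = |⟪n, e⟫| * ∫ x in F, φ x ∂(Measure.euclideanHausdorffMeasure (d - 1)) := by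
  have hc : Measurable (fun q : (ℝ ∙ n)ᗮ × ℝ => hyperplaneMap n p q.1 + q.2 • e) := by
    have := (hyperplaneMap n p).continuous
    fun_prop
  have hm := measurableSet_shadow n p e hF
  have hcont : Continuous fun z => fderiv ℝ φ z e :=
    (hφ.continuous_fderiv one_ne_zero).clm_apply continuous_const
  have hint : Integrable (fun z => fderiv ℝ φ z e) :=
    hcont.integrable_of_hasCompactSupport (hφc.fderiv_apply (𝕜 := ℝ) e)
  have h1 : (volume : Measure (E d)) = ENNReal.ofReal |⟪n, e⟫| •
      Measure.map (fun q : (ℝ ∙ n)ᗮ × ℝ => hyperplaneMap n p q.1 + q.2 • e) volume := by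
    rw [map_hyperplaneMap_add_smul hn p hne, smul_smul, ← ENNReal.ofReal_mul (abs_nonneg _),
      ← abs_mul, mul_inv_cancel₀ hne]
    simp
  have hint' : Integrable ((shadow n p e F).indicator fun z => fderiv ℝ φ z e)
      (Measure.map (fun q : (ℝ ∙ n)ᗮ × ℝ => hyperplaneMap n p q.1 + q.2 • e) volume) := by
    rw [map_hyperplaneMap_add_smul hn p hne]
    exact (hint.indicator hm).smul_measure ENNReal.ofReal_ne_top
  have hsm := hint'.aestronglyMeasurable
  rw [integrable_map_measure hsm hc.aemeasurable] at hint'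
  rw [← integral_indicator hm, h1, integral_smul_measure, integral_map hc.aemeasurable hsm,
    ENNReal.toReal_ofReal (abs_nonneg _), smul_eq_mul,
    setIntegral_eq_integral_hyperplaneMap hn hF hFH, Measure.volume_eq_prod,
    integral_prod (fun q : (ℝ ∙ n)ᗮ × ℝ => (shadow n p e F).indicator (fun z => fderiv ℝ φ z e)
      (hyperplaneMap n p q.1 + q.2 • e)) hint']
  congr 1
  refine integral_congr_ae (Eventually.of_forall fun a => ?_)
  have hx := inner_hyperplaneMap_sub n p a
  change ∫ s : ℝ, (shadow n p e F).indicator (fun z => fderiv ℝ φ z e) (hyperplaneMap n p a + s • e)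
    = F.indicator φ (hyperplaneMap n p a)
  generalize hyperplaneMap n p a = x at hx ⊢
  have h2 : ∀ s : ℝ, (shadow n p e F).indicator (fun z => fderiv ℝ φ z e) (x + s • e)
      = (Iic (0 : ℝ)).indicator (fun s => F.indicator (fun _ => fderiv ℝ φ (x + s • e) e) x) s := by
    intro s
    by_cases hs : s ≤ 0 <;> by_cases hxF : x ∈ F <;>
      simp [indicator, shadow, hitTime_add_smul hne hx, hitPoint_add_smul hne hx, hs, hxF]
  simp only [h2]
  rw [integral_indicator measurableSet_Iic]
  by_cases hxF : x ∈ F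
  · simp only [indicator_of_mem hxF]
    have hline : ContDiff ℝ 1 fun s : ℝ => φ (x + s • e) := by fun_prop
    have hder : ∀ s : ℝ, fderiv ℝ φ (x + s • e) e = deriv (fun s : ℝ => φ (x + s • e)) s := by
      intro s
      have h3 : HasDerivAt (fun s : ℝ => x + s • e) e s := by
        simpa using ((hasDerivAt_id s).smul_const e).const_add x
      exact (((hφ.differentiable one_ne_zero _).hasFDerivAt.comp_hasDerivAt s h3).deriv).symm
    have he : e ≠ 0 := by rintro rfl; simp at hne
    have hemb : IsClosedEmbedding fun s : ℝ => x + s • e :=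
      (Homeomorph.addLeft x).isClosedEmbedding.comp (isClosedEmbedding_smul_left he)
    simp only [hder]
    rw [HasCompactSupport.integral_Iic_deriv_eq hline (hφc.comp_isClosedEmbedding hemb)]
    simp
  · simp [indicator_of_notMem hxF]

/-- Transported isometrically to `(ℝ ∙ n)ᗮ`, this is the Lebesgue-nullity of the frontier of a
convex set. -/
theorem euclideanHausdorffMeasure_intrinsicFrontier {n : E d} (hn : ‖n‖ = 1) {p : E d}
    {F : Set (E d)} (hF : Convex ℝ F) (hFH : ∀ x ∈ F, ⟪n, x - p⟫ = 0) :
    Measure.euclideanHausdorffMeasure (d - 1) (intrinsicFrontier ℝ F) = 0 := by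
  have h1 := (image_preimage_hyperplaneMap hFH).symm
  have hF' : Convex ℝ (hyperplaneMap n p ⁻¹' F) :=
    hF.affine_preimage (hyperplaneMap n p).toAffineMap
  rw [h1, AffineIsometry.intrinsicFrontier_image,
    (hyperplaneMap n p).isometry.euclideanHausdorffMeasure_image, ← finrank_orthogonal_unit hn,
    InnerProductSpace.euclideanHausdorffMeasure_eq_volume]
  exact measure_mono_null intrinsicFrontier_subset_frontier (hF'.addHaar_frontier volume)

theorem euclideanHausdorffMeasure_lt_top_of_isCompact {n : E d} (hn : ‖n‖ = 1) {p : E d}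
    {F : Set (E d)} (hF : IsCompact F) (hFH : ∀ x ∈ F, ⟪n, x - p⟫ = 0) :
    Measure.euclideanHausdorffMeasure (d - 1) F < ⊤ := by
  have h1 := (image_preimage_hyperplaneMap hFH).symm
  rw [h1, (hyperplaneMap n p).isometry.euclideanHausdorffMeasure_image,
    ← finrank_orthogonal_unit hn, InnerProductSpace.euclideanHausdorffMeasure_eq_volume]
  exact ((hyperplaneMap n p).isometry.isClosedEmbedding.isCompact_preimage hF).measure_lt_top

theorem volume_hyperplane {n : E d} (hn : ‖n‖ = 1) (p : E d) :
    volume {x : E d | ⟪n, x - p⟫ = 0} = 0 := by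
  have h := Measure.addHaar_affineSubspace (volume : Measure (E d))
    (AffineSubspace.mk' p (ℝ ∙ n)ᗮ) (fun h => by
      have h1 : p + n ∈ AffineSubspace.mk' p (ℝ ∙ n)ᗮ := by rw [h]; trivial
      rw [AffineSubspace.mem_mk', Submodule.mem_orthogonal_singleton_iff_inner_right] at h1
      simp [hn] at h1)
  refine measure_mono_null (fun x hx => ?_) h
  exact (AffineSubspace.mem_mk' ..).2 (Submodule.mem_orthogonal_singleton_iff_inner_right.2 hx)

end Cylinder

/-! ### Polytopal elements and the signed count of face crossings. -/

theorem IsFlatFace.convex {d : ℕ} {F : Set (E d)} (h : IsFlatFace F) : Convex ℝ F := by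
  obtain ⟨⟨s, rfl⟩, -⟩ := h
  exact convex_convexHull ℝ _

theorem IsFlatFace.isCompact {d : ℕ} {F : Set (E d)} (h : IsFlatFace F) : IsCompact F := by
  obtain ⟨⟨s, rfl⟩, -⟩ := h
  exact s.finite_toSet.isCompact_convexHull ℝ

/-- `K` is a bounded open set whose boundary is composed of the non-overlapping flat faces in `𝓕`,
with outward unit normals `ν F`; the point `p F` lies in the hyperplane spanned by `F`. -/
structure IsPolytopal {d : ℕ} (K : Set (E d)) (𝓕 : Finset (Set (E d))) (ν p : Set (E d) → E d) :
    Prop where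
  isOpen : IsOpen K
  isBounded : Bornology.IsBounded K
  frontier_eq : frontier K = ⋃ F ∈ 𝓕, F
  isFlatFace : ∀ F ∈ 𝓕, IsFlatFace F
  disjoint_faces : ∀ F ∈ 𝓕, ∀ G ∈ 𝓕, F ≠ G →
    Disjoint (intrinsicInterior ℝ F) (intrinsicInterior ℝ G)
  isOutwardNormal : ∀ F ∈ 𝓕, IsOutwardNormal K F (ν F)
  inner_sub_eq_zero : ∀ F ∈ 𝓕, ∀ x ∈ F, ⟪ν F, x - p F⟫ = 0

theorem mem_intrinsicFrontier_of_mem_inter {d : ℕ} {F G : Set (E d)} (hF : IsClosed F)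
    (hG : IsClosed G) (h : Disjoint (intrinsicInterior ℝ F) (intrinsicInterior ℝ G)) {x : E d}
    (hxF : x ∈ F) (hxG : x ∈ G) : x ∈ intrinsicFrontier ℝ F ∨ x ∈ intrinsicFrontier ℝ G := by
  by_contra! hc
  rw [← closure_sdiff_intrinsicInterior, ← closure_sdiff_intrinsicInterior, hF.closure_eq,
    hG.closure_eq] at hc
  exact disjoint_left.1 h (by_contra fun h' => hc.1 ⟨hxF, h'⟩) (by_contra fun h' => hc.2 ⟨hxG, h'⟩)

theorem mem_intrinsicInterior_of_notMem_intrinsicFrontier {d : ℕ} {F : Set (E d)}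
    (hF : IsClosed F) {x : E d} (hxF : x ∈ F) (hx : x ∉ intrinsicFrontier ℝ F) :
    x ∈ intrinsicInterior ℝ F := by
  rw [← closure_sdiff_intrinsicInterior, hF.closure_eq] at hx
  exact by_contra fun h' => hx ⟨hxF, h'⟩

theorem inter_frontier_nonempty_of_isPreconnected {X : Type*} [TopologicalSpace X] {A S : Set X}
    (hA : IsPreconnected A) (h1 : (A ∩ S).Nonempty) (h2 : (A ∩ Sᶜ).Nonempty) :
    (A ∩ frontier S).Nonempty := by
  by_contra hne
  rw [not_nonempty_iff_eq_empty, eq_empty_iff_forall_notMem] at hne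
  have hi : ∀ x ∈ A, x ∈ closure S → x ∈ interior S := fun x hx hc =>
    by_contra fun hi => hne x ⟨hx, hc, hi⟩
  obtain ⟨x, hx, hxS⟩ := h1
  obtain ⟨y, hy, hyS⟩ := h2
  obtain ⟨w, hw, hw1, hw2⟩ := hA _ _ isOpen_interior isClosed_closure.isOpen_compl
    (fun w hw => (em (w ∈ closure S)).imp (hi w hw) id) ⟨x, hx, hi x hx (subset_closure hxS)⟩
    ⟨y, hy, fun hc => hyS (interior_subset (hi y hy hc))⟩
  exact hw2 (subset_closure (interior_subset hw1))

namespace IsPolytopal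

variable {d : ℕ} {K : Set (E d)} {𝓕 : Finset (Set (E d))} {ν p : Set (E d) → E d}

theorem norm_normal (h : IsPolytopal K 𝓕 ν p) {F : Set (E d)} (hF : F ∈ 𝓕) : ‖ν F‖ = 1 :=
  (h.isOutwardNormal F hF).1

theorem isClosed_face (h : IsPolytopal K 𝓕 ν p) {F : Set (E d)} (hF : F ∈ 𝓕) : IsClosed F :=
  (h.isFlatFace F hF).isCompact.isClosed

/-- Near a relative interior point of a face that lies on no other face, the element is a
half-ball. -/
theorem exists_ball (h : IsPolytopal K 𝓕 ν p) {F : Set (E d)} (hF : F ∈ 𝓕) {x : E d}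
    (hx : x ∈ intrinsicInterior ℝ F) (hx' : ∀ G ∈ 𝓕, G ≠ F → x ∉ G) :
    ∃ r > 0, ∀ y ∈ Metric.ball x r,
      (⟪ν F, y - x⟫ < 0 → y ∈ K) ∧ (0 < ⟪ν F, y - x⟫ → y ∉ closure K) := by
  classical
  obtain ⟨hn, hperp, hside⟩ := h.isOutwardNormal F hF
  have hxF := intrinsicInterior_subset hx
  have hC : IsClosed (⋃ G ∈ 𝓕.erase F, G) :=
    (𝓕.erase F).finite_toSet.isClosed_biUnion fun G hG =>
      h.isClosed_face (Finset.mem_of_mem_erase hG)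
  have hxC : x ∈ (⋃ G ∈ 𝓕.erase F, G)ᶜ := by
    simp only [mem_compl_iff, mem_iUnion, not_exists]
    exact fun G hG => hx' G (Finset.mem_of_mem_erase hG) (Finset.ne_of_mem_erase hG)
  obtain ⟨r, hr, hball⟩ := Metric.isOpen_iff.1 hC.isOpen_compl x hxC
  have hfr : ∀ y ∈ Metric.ball x r, y ∈ frontier K → ⟪ν F, y - x⟫ = 0 := by
    intro y hy hyK
    rw [h.frontier_eq] at hyK
    obtain ⟨G, hG, hyG⟩ := mem_iUnion₂.1 hyK
    by_cases hGF : G = F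
    · subst hGF
      exact hperp y hyG x hxF
    · exact absurd (mem_iUnion₂.2 ⟨G, Finset.mem_erase.2 ⟨hGF, hG⟩, hyG⟩) (hball hy)
  -- Neither open half-ball meets the frontier, and each is convex, hence connected. One sample
  -- point on each side, supplied by the outward normal, decides the whole half-ball.
  obtain ⟨t, ⟨hK, hK'⟩, ht0, htr⟩ := ((hside x hx).and (Ioo_mem_nhdsGT hr)).exists
  have hlin : IsLinearMap ℝ fun y : E d => ⟪ν F, y⟫ :=
    ⟨fun a b => inner_add_right _ _ _, fun a b => inner_smul_right _ _ _⟩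
  have hconv1 : Convex ℝ (Metric.ball x r ∩ {y | ⟪ν F, y - x⟫ < 0}) := by
    refine (convex_ball x r).inter ?_
    simpa only [inner_sub_right, sub_neg] using convex_halfSpace_lt hlin ⟪ν F, x⟫
  have hconv2 : Convex ℝ (Metric.ball x r ∩ {y | 0 < ⟪ν F, y - x⟫}) := by
    refine (convex_ball x r).inter ?_
    simpa only [inner_sub_right, sub_pos] using convex_halfSpace_gt hlin ⟪ν F, x⟫
  have hnorm : ‖t • ν F‖ < r := by
    rw [norm_smul, hn, mul_one, Real.norm_of_nonneg ht0.le]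
    exact htr
  refine ⟨r, hr, fun y hy => ⟨fun hneg => ?_, fun hpos hyc => ?_⟩⟩
  · by_contra hyK
    obtain ⟨w, ⟨hw1, hw2⟩, hw3⟩ := inter_frontier_nonempty_of_isPreconnected hconv1.isPreconnected
      ⟨x - t • ν F, ⟨by simpa [dist_eq_norm] using hnorm, by
        simpa [inner_smul_right, hn] using ht0⟩, hK⟩ ⟨y, ⟨hy, hneg⟩, hyK⟩
    exact (ne_of_lt hw2) (hfr w hw1 hw3)
  · obtain ⟨w, ⟨hw1, hw2⟩, hw3⟩ := inter_frontier_nonempty_of_isPreconnected hconv2.isPreconnected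
      ⟨y, ⟨hy, hpos⟩, hyc⟩ ⟨x + t • ν F, ⟨by simpa [dist_eq_norm] using hnorm, by
        simpa [inner_smul_right, hn] using ht0⟩, hK'⟩
    exact (ne_of_gt hw2) (hfr w hw1 (frontier_closure_subset hw3))

theorem sum_sign_eventually_eq (s : Finset (Set (E d))) (σ t : Set (E d) → ℝ)
    (P : Set (E d) → Prop) (u : ℝ) (hu : ∀ F ∈ s, σ F ≠ 0 → P F → t F ≠ u) :
    ∀ᶠ v in 𝓝 u, ∑ F ∈ s, σ F * {v : ℝ | P F ∧ v < t F}.indicator 1 v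
      = ∑ F ∈ s, σ F * {v : ℝ | P F ∧ v < t F}.indicator 1 u := by
  have h1 : ∀ F ∈ s, ∀ᶠ v in 𝓝 u, σ F * {v : ℝ | P F ∧ v < t F}.indicator 1 v
      = σ F * {v : ℝ | P F ∧ v < t F}.indicator (1 : ℝ → ℝ) u := by
    intro F hF
    by_cases hσ : σ F = 0
    · simp [hσ]
    by_cases hP : P F
    · rcases lt_or_gt_of_ne (hu F hF hσ hP) with hlt | hgt
      · filter_upwards [lt_mem_nhds hlt] with v hv
        simp [indicator, hv.le.not_gt, hlt.le.not_gt]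
      · filter_upwards [gt_mem_nhds hgt] with v hv
        simp [indicator, hP, hv, hgt]
    · simp [indicator, hP]
  filter_upwards [(Finset.eventually_all s).2 h1] with v hv
  exact Finset.sum_congr rfl hv

open Classical in
/-- A generic line starting at `z` leaves and enters `K` through the faces that it crosses, so the
signed number of crossings is the indicator function of `K` at `z`. -/
theorem indicator_eq_sum_shadow (h : IsPolytopal K 𝓕 ν p) {e z : E d} (he : e ≠ 0)
    (hpar : ∀ F ∈ 𝓕, ⟪ν F, e⟫ = 0 → ⟪ν F, z - p F⟫ ≠ 0)
    (hbd : ∀ F ∈ 𝓕, ⟪ν F, e⟫ ≠ 0 → hitPoint (ν F) (p F) e z ∉ intrinsicFrontier ℝ F)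
    (hz : z ∉ frontier K) :
    K.indicator (1 : E d → ℝ) z = ∑ F ∈ 𝓕, (SignType.sign ⟪ν F, e⟫ : ℝ) *
      (shadow (ν F) (p F) e F).indicator 1 z := by
  have hcross : ∀ F ∈ 𝓕, ∀ u : ℝ, z + u • e ∈ F → ⟪ν F, e⟫ ≠ 0 ∧
      hitTime (ν F) (p F) e z = u ∧ hitPoint (ν F) (p F) e z = z + u • e := by
    intro F hF u hu
    have h1 := h.inner_sub_eq_zero F hF _ hu
    have hne : ⟪ν F, e⟫ ≠ 0 := by
      intro h0
      refine hpar F hF h0 ?_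
      rw [add_sub_right_comm, inner_add_right, inner_smul_right, h0] at h1
      simpa using h1
    have h2 : z = z + u • e + (-u) • e := by module
    refine ⟨hne, ?_, ?_⟩
    · rw [h2, hitTime_add_smul hne h1, neg_neg]
    · rw [h2, hitPoint_add_smul hne h1, ← h2]
  have hline : Continuous fun u : ℝ => z + u • e := by fun_prop
  have hin : ∀ u : ℝ, z + u • e ∈ K → ∀ᶠ v in 𝓝[>] u, z + v • e ∈ K := fun u hu =>
    (hline.continuousAt.eventually (h.isOpen.mem_nhds hu)).filter_mono nhdsWithin_le_nhds
  have hout : ∀ u : ℝ, z + u • e ∉ closure K → ¬ ∀ᶠ v in 𝓝[>] u, z + v • e ∈ K := by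
    intro u hu hev
    have h1 : ∀ᶠ v in 𝓝[>] u, z + v • e ∈ (closure K)ᶜ :=
      (hline.continuousAt.eventually (isClosed_closure.isOpen_compl.mem_nhds hu)).filter_mono
        nhdsWithin_le_nhds
    obtain ⟨v, hv1, hv2⟩ := (hev.and h1).exists
    exact hv2 (subset_closure hv1)
  -- `χ` records whether the line lies in `K` just after time `u`. It is thus right-continuous at a
  -- crossing, matching the strict inequality `v < t F` in `f`, so that `χ - ∑ f` is locally
  -- constant even at crossing times.
  let χ : ℝ → ℝ := fun u => if ∀ᶠ v in 𝓝[>] u, z + v • e ∈ K then 1 else 0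
  let σ : Set (E d) → ℝ := fun F => (SignType.sign ⟪ν F, e⟫ : ℝ)
  let t : Set (E d) → ℝ := fun F => hitTime (ν F) (p F) e z
  let P : Set (E d) → Prop := fun F => hitPoint (ν F) (p F) e z ∈ F
  let f : Set (E d) → ℝ → ℝ := fun F v => σ F * {v : ℝ | P F ∧ v < t F}.indicator 1 v
  have hconst : IsLocallyConstant fun u => χ u - ∑ F ∈ 𝓕, f F u := by
    rw [IsLocallyConstant.iff_eventually_eq]
    intro u
    by_cases hu : ∃ F ∈ 𝓕, z + u • e ∈ F
    · obtain ⟨F, hF, huF⟩ := hu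
      obtain ⟨hne, htF, hpF⟩ := hcross F hF u huF
      -- Two faces can meet only in a relative boundary, which the generic line avoids, so each
      -- crossing involves a single face.
      have hother : ∀ G ∈ 𝓕, G ≠ F → z + u • e ∉ G := by
        intro G hG hGF huG
        obtain ⟨hneG, -, hpG⟩ := hcross G hG u huG
        rcases mem_intrinsicFrontier_of_mem_inter (h.isClosed_face hG) (h.isClosed_face hF)
          (h.disjoint_faces G hG F hF hGF) huG huF with h1 | h1
        · exact hbd G hG hneG (hpG ▸ h1)
        · exact hbd F hF hne (hpF ▸ h1)
      have hint : z + u • e ∈ intrinsicInterior ℝ F :=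
        mem_intrinsicInterior_of_notMem_intrinsicFrontier (h.isClosed_face hF) huF
          (hpF ▸ hbd F hF hne)
      obtain ⟨r, hr, hball⟩ := h.exists_ball hF hint hother
      have hinner : ∀ v : ℝ, ⟪ν F, z + v • e - (z + u • e)⟫ = (v - u) * ⟪ν F, e⟫ := by
        intro v
        rw [← inner_smul_right]
        congr 1
        module
      have hev : ∀ᶠ v in 𝓝 u, z + v • e ∈ Metric.ball (z + u • e) r :=
        hline.continuousAt.eventually (Metric.ball_mem_nhds _ hr)
      have hsum := sum_sign_eventually_eq (𝓕.erase F) σ t P u (by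
        intro G hG hσ hPG htG
        have hcG : ⟪ν G, e⟫ ≠ 0 := fun h0 => hσ (by simp [σ, h0])
        refine hother G (Finset.mem_of_mem_erase hG) (Finset.ne_of_mem_erase hG) ?_
        rw [← htG]
        exact hPG)
      have hPF : P F := by
        change hitPoint (ν F) (p F) e z ∈ F
        rw [hpF]
        exact huF
      have hfF : ∀ v, f F v = σ F * if v < u then 1 else 0 := by
        intro v
        have : t F = u := htF
        simp [f, indicator, hPF, this]
      -- The line enters `K` if `⟪ν F, e⟫ < 0` and leaves it if `⟪ν F, e⟫ > 0`; in both cases `χ`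
      -- and `f F` jump by the same amount, `+1` or `-1`.
      have key : ∀ᶠ v in 𝓝 u, χ v - f F v = χ u - f F u := by
        rcases lt_or_gt_of_ne hne with hneg | hpos
        · have hχu : χ u = 1 := by
            refine if_pos ?_
            filter_upwards [hev.filter_mono nhdsWithin_le_nhds, self_mem_nhdsWithin] with v hv hvu
            refine (hball _ hv).1 ?_
            rw [hinner]
            exact mul_neg_of_pos_of_neg (sub_pos.2 hvu) hneg
          filter_upwards [hev] with v hv
          have hσF : σ F = -1 := by simp [σ, sign_neg hneg]
          rw [hfF, hfF, hχu, hσF]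
          rcases lt_trichotomy v u with hvu | rfl | hvu
          · have : χ v = 0 := by
              refine if_neg (hout v ((hball _ hv).2 ?_))
              rw [hinner]
              exact mul_pos_of_neg_of_neg (sub_neg.2 hvu) hneg
            simp [this, hvu]
          · simp [hχu]
          · have : χ v = 1 := by
              refine if_pos (hin v ((hball _ hv).1 ?_))
              rw [hinner]
              exact mul_neg_of_pos_of_neg (sub_pos.2 hvu) hneg
            simp [this, hvu.le.not_gt]
        · have hχu : χ u = 0 := by
            refine if_neg fun hK => ?_
            obtain ⟨v, ⟨hv, hvu⟩, hvK⟩ := (((hev.filter_mono nhdsWithin_le_nhds).and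
              (self_mem_nhdsWithin : ∀ᶠ v in 𝓝[>] u, v ∈ Ioi u)).and hK).exists
            refine (hball _ hv).2 ?_ (subset_closure hvK)
            rw [hinner]
            exact mul_pos (sub_pos.2 hvu) hpos
          filter_upwards [hev] with v hv
          have hσF : σ F = 1 := by simp [σ, sign_pos hpos]
          rw [hfF, hfF, hχu, hσF]
          rcases lt_trichotomy v u with hvu | rfl | hvu
          · have : χ v = 1 := by
              refine if_pos (hin v ((hball _ hv).1 ?_))
              rw [hinner]
              exact mul_neg_of_neg_of_pos (sub_neg.2 hvu) hpos
            simp [this, hvu]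
          · simp [hχu]
          · have : χ v = 0 := by
              refine if_neg (hout v ((hball _ hv).2 ?_))
              rw [hinner]
              exact mul_pos (sub_pos.2 hvu) hpos
            simp [this, hvu.le.not_gt]
      filter_upwards [key, hsum] with v hv1 hv2
      have hv2' : ∑ G ∈ 𝓕.erase F, f G v = ∑ G ∈ 𝓕.erase F, f G u := hv2
      rw [← Finset.add_sum_erase _ (fun G => f G v) hF,
        ← Finset.add_sum_erase _ (fun G => f G u) hF, hv2']
      linarith
    · push Not at hu
      have hfr : z + u • e ∉ frontier K := by
        rw [h.frontier_eq]
        simpa using hu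
      have hsum := sum_sign_eventually_eq 𝓕 σ t P u (by
        intro G hG hσ hPG htG
        refine hu G hG ?_
        rw [← htG]
        exact hPG)
      have key : ∀ᶠ v in 𝓝 u, χ v = χ u := by
        by_cases huK : z + u • e ∈ K
        · filter_upwards [hline.continuousAt.eventually (h.isOpen.mem_nhds huK)] with v hv
          simp only [χ]
          rw [if_pos (hin v hv), if_pos (hin u huK)]
        · have huc : z + u • e ∉ closure K := fun hc =>
            hfr ⟨hc, fun hi => huK (interior_subset hi)⟩
          filter_upwards [hline.continuousAt.eventually
            (isClosed_closure.isOpen_compl.mem_nhds huc)] with v hv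
          simp only [χ]
          rw [if_neg (hout v hv), if_neg (hout u huc)]
      filter_upwards [key, hsum] with v hv1 hv2
      have hv2' : ∑ G ∈ 𝓕, f G v = ∑ G ∈ 𝓕, f G u := hv2
      rw [hv1, hv2']
  obtain ⟨R, hR⟩ := h.isBounded.subset_ball (0 : E d)
  have hlarge : ∀ᶠ u : ℝ in atTop, z + u • e ∉ K := by
    filter_upwards [eventually_ge_atTop ((R + ‖z‖) / ‖e‖), eventually_ge_atTop 0] with u hu hu0 hK
    have h1 : ‖z + u • e‖ < R := by simpa using hR hK
    have h2 : ‖u • e‖ ≤ ‖z + u • e‖ + ‖z‖ := by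
      have := norm_sub_le (z + u • e) z
      simpa using this
    rw [norm_smul, Real.norm_of_nonneg hu0] at h2
    rw [div_le_iff₀ (norm_pos_iff.2 he)] at hu
    linarith
  have hlarge' : ∀ᶠ u : ℝ in atTop, ∀ F ∈ 𝓕, t F ≤ u :=
    (Finset.eventually_all 𝓕).2 fun F _ => eventually_ge_atTop _
  -- Beyond all crossings and outside the bounded set `K`, both `χ` and the sum vanish; the locally
  -- constant difference is then zero at time `0` too.
  obtain ⟨u, hu1, hu2⟩ := ((eventually_forall_ge_atTop.2 hlarge).and hlarge').exists
  have hq := hconst.apply_eq_of_isPreconnected isPreconnected_univ (mem_univ (0 : ℝ)) (mem_univ u)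
  have hχu : χ u = 0 := by
    refine if_neg fun hK => ?_
    obtain ⟨v, hv, hvu⟩ := (hK.and (self_mem_nhdsWithin : ∀ᶠ v in 𝓝[>] u, v ∈ Ioi u)).exists
    exact hu1 v (le_of_lt hvu) hv
  have hfu : ∑ F ∈ 𝓕, f F u = 0 := by
    refine Finset.sum_eq_zero fun F hF => ?_
    simp [f, indicator, (hu2 F hF).not_gt]
  have hχ0 : χ 0 = K.indicator (1 : E d → ℝ) z := by
    have hz0 : z + (0 : ℝ) • e = z := by simp
    by_cases hzK : z ∈ K
    · rw [indicator_of_mem hzK]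
      exact if_pos (hin 0 (by rwa [hz0]))
    · rw [indicator_of_notMem hzK]
      refine if_neg (hout 0 ?_)
      rw [hz0]
      exact fun hc => hz ⟨hc, fun hi => hzK (interior_subset hi)⟩
  have hf0 : ∀ F ∈ 𝓕, f F 0 = (SignType.sign ⟪ν F, e⟫ : ℝ) *
      (shadow (ν F) (p F) e F).indicator 1 z := by
    intro F hF
    -- The shadow uses `≤` where `f` uses `<`; they agree because hitting a face at time `0` would
    -- put `z` on the frontier.
    have hiff : P F → (0 < t F ↔ 0 ≤ t F) := by
      refine fun hPF => ⟨le_of_lt, fun h0 => lt_of_le_of_ne h0 fun h1 => hz ?_⟩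
      rw [h.frontier_eq]
      refine mem_iUnion₂.2 ⟨F, hF, ?_⟩
      have h2 : hitPoint (ν F) (p F) e z = z := by
        rw [hitPoint, show hitTime (ν F) (p F) e z = 0 from h1.symm]
        simp
      rw [← h2]
      exact hPF
    by_cases hPF : P F
    · have := hiff hPF
      simp only [f, σ, indicator, shadow, mem_ofPred_eq]
      congr 1
      simp only [hPF, true_and, this]
      simp only [t, P] at hPF ⊢
      simp [hPF]
    · have : z ∉ shadow (ν F) (p F) e F := fun hs => hPF hs.2
      simp [f, hPF, this]
  rw [← Finset.sum_congr rfl hf0, ← hχ0]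
  simp only [hχu, hfu] at hq
  linarith

end IsPolytopal

/-! ### The divergence theorem on a polytopal element. -/

theorem integrableOn_of_isCompact_of_lt_top {X : Type*} [TopologicalSpace X] [MeasurableSpace X]
    [OpensMeasurableSpace X] {μ : Measure X} {F : Set X} (hF : IsCompact F) (hFm : MeasurableSet F)
    (hμ : μ F < ⊤) {f : X → ℝ} (hf : ContinuousOn f F) : IntegrableOn f F μ := by
  obtain ⟨C, hC⟩ := hF.exists_bound_of_continuousOn hf
  refine ⟨hf.aestronglyMeasurable_of_isCompact hF hFm, ?_⟩
  have : IsFiniteMeasure (μ.restrict F) := ⟨by simpa using hμ⟩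
  exact HasFiniteIntegral.of_bounded ((ae_restrict_iff' hFm).2 (Eventually.of_forall hC))

theorem integrableOn_of_isBounded {d : ℕ} {K : Set (E d)} (hK : Bornology.IsBounded K)
    {f : E d → ℝ} (hf : Continuous f) : IntegrableOn f K :=
  (hf.continuousOn.integrableOn_compact hK.isCompact_closure).mono_set subset_closure

theorem continuous_divergence {d : ℕ} {G : E d → E d} (hG : ContDiff ℝ 1 G) :
    Continuous (divergence G) := by
  have := hG.continuous_fderiv one_ne_zero
  unfold divergence
  fun_prop

namespace IsPolytopal

variable {d : ℕ} {K : Set (E d)} {𝓕 : Finset (Set (E d))} {ν p : Set (E d) → E d}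

theorem face_subset (h : IsPolytopal K 𝓕 ν p) {F : Set (E d)} (hF : F ∈ 𝓕) : F ⊆ closure K :=
  (subset_biUnion_of_mem (u := fun F => F) hF).trans
    (h.frontier_eq.symm.subset.trans frontier_subset_closure)

theorem integrableOn_face (h : IsPolytopal K 𝓕 ν p) {F : Set (E d)} (hF : F ∈ 𝓕) {f : E d → ℝ}
    (hf : ContinuousOn f F) :
    IntegrableOn f F (Measure.euclideanHausdorffMeasure (d - 1)) :=
  integrableOn_of_isCompact_of_lt_top (h.isFlatFace F hF).isCompact (h.isClosed_face hF).measurableSet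
    (euclideanHausdorffMeasure_lt_top_of_isCompact (h.norm_normal hF) (h.isFlatFace F hF).isCompact
      (h.inner_sub_eq_zero F hF)) hf

theorem volume_frontier (h : IsPolytopal K 𝓕 ν p) : volume (frontier K) = 0 := by
  rw [h.frontier_eq]
  refine (measure_biUnion_null_iff 𝓕.countable_toSet).2 ?_
  exact fun F hF => measure_mono_null (fun x hx => h.inner_sub_eq_zero F hF x hx)
    (volume_hyperplane (h.norm_normal hF) (p F))

theorem ae_indicator_eq_sum_shadow (h : IsPolytopal K 𝓕 ν p) {e : E d} (he : e ≠ 0) :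
    ∀ᵐ z : E d, K.indicator (1 : E d → ℝ) z = ∑ F ∈ 𝓕, (SignType.sign ⟪ν F, e⟫ : ℝ) *
      (shadow (ν F) (p F) e F).indicator 1 z := by
  have h1 : ∀ᵐ z : E d, ∀ F ∈ 𝓕, ⟪ν F, e⟫ = 0 → ⟪ν F, z - p F⟫ ≠ 0 := by
    refine (Finset.eventually_all 𝓕).2 fun F hF => ?_
    filter_upwards [measure_eq_zero_iff_ae_notMem.1 (volume_hyperplane (h.norm_normal hF) (p F))]
      with z hz _ using hz
  have h2 : ∀ᵐ z : E d, ∀ F ∈ 𝓕, ⟪ν F, e⟫ ≠ 0 →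
      hitPoint (ν F) (p F) e z ∉ intrinsicFrontier ℝ F := by
    refine (Finset.eventually_all 𝓕).2 fun F hF => ?_
    by_cases hne : ⟪ν F, e⟫ = 0
    · simp [hne]
    have hc : IsClosed (intrinsicFrontier ℝ F) :=
      isClosed_intrinsicFrontier (AffineSubspace.closed_of_finiteDimensional _)
    filter_upwards [measure_eq_zero_iff_ae_notMem.1 (hitPoint_mem_null (h.norm_normal hF) hne
      hc.measurableSet (euclideanHausdorffMeasure_intrinsicFrontier (h.norm_normal hF)
        (h.isFlatFace F hF).convex (h.inner_sub_eq_zero F hF)))] with z hz _ using hz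
  filter_upwards [h1, h2, measure_eq_zero_iff_ae_notMem.1 h.volume_frontier] with z hz1 hz2 hz3
  exact h.indicator_eq_sum_shadow he hz1 hz2 hz3

/-- Multiply the crossing identity by the directional derivative and integrate: the sign of `⟪ν F,
e⟫` times the Jacobian `|⟪ν F, e⟫|` restores `⟪ν F, e⟫`. -/
theorem integral_fderiv_of_hasCompactSupport (h : IsPolytopal K 𝓕 ν p) {φ : E d → ℝ}
    (hφ : ContDiff ℝ 1 φ) (hφc : HasCompactSupport φ) (e : E d) :
    ∫ z in K, fderiv ℝ φ z e
      = ∑ F ∈ 𝓕, ⟪ν F, e⟫ * ∫ x in F, φ x ∂(Measure.euclideanHausdorffMeasure (d - 1)) := by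
  rcases eq_or_ne e 0 with rfl | he
  · simp
  have hint : Integrable (fun z => fderiv ℝ φ z e) :=
    ((hφ.continuous_fderiv one_ne_zero).clm_apply continuous_const).integrable_of_hasCompactSupport
      (hφc.fderiv_apply (𝕜 := ℝ) e)
  have hm : ∀ F ∈ 𝓕, MeasurableSet (shadow (ν F) (p F) e F) := fun F hF =>
    measurableSet_shadow _ _ _ (h.isClosed_face hF).measurableSet
  have h1 : ∀ᵐ z : E d, K.indicator (fun z => fderiv ℝ φ z e) z
      = ∑ F ∈ 𝓕, (SignType.sign ⟪ν F, e⟫ : ℝ) *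
        (shadow (ν F) (p F) e F).indicator (fun z => fderiv ℝ φ z e) z := by
    filter_upwards [h.ae_indicator_eq_sum_shadow he] with z hz
    have h2 : ∀ S : Set (E d), S.indicator (fun z => fderiv ℝ φ z e) z
        = S.indicator (1 : E d → ℝ) z * fderiv ℝ φ z e := by
      intro S
      by_cases hzS : z ∈ S <;> simp [hzS]
    simp only [h2, hz, Finset.sum_mul, mul_assoc]
  rw [← integral_indicator h.isOpen.measurableSet, integral_congr_ae h1, integral_finsetSum _
    fun F hF => (hint.indicator (hm F hF)).const_mul _]
  refine Finset.sum_congr rfl fun F hF => ?_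
  rw [integral_const_mul, integral_indicator (hm F hF)]
  by_cases hne : ⟪ν F, e⟫ = 0
  · simp [hne]
  rw [integral_shadow (h.norm_normal hF) hne (h.isClosed_face hF).measurableSet
    (h.inner_sub_eq_zero F hF) hφ hφc, ← mul_assoc, sign_mul_abs]

theorem integral_fderiv (h : IsPolytopal K 𝓕 ν p) {φ : E d → ℝ} (hφ : ContDiff ℝ 1 φ) (e : E d) :
    ∫ z in K, fderiv ℝ φ z e
      = ∑ F ∈ 𝓕, ⟪ν F, e⟫ * ∫ x in F, φ x ∂(Measure.euclideanHausdorffMeasure (d - 1)) := by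
  obtain ⟨R, hR, hKR⟩ := h.isBounded.closure.subset_ball_lt 0 (0 : E d)
  -- A cutoff equal to one near `closure K` changes neither the volume nor the face integrals.
  let χ : ContDiffBump (0 : E d) := ⟨R, R + 1, hR, by linarith⟩
  have hχ : ∀ x ∈ closure K, (fun z => χ z * φ z) =ᶠ[𝓝 x] φ := by
    intro x hx
    filter_upwards [Metric.isOpen_ball.mem_nhds (hKR hx)] with z hz
    rw [χ.one_of_mem_closedBall (Metric.ball_subset_closedBall hz), one_mul]
  have h1 := h.integral_fderiv_of_hasCompactSupport (φ := fun z => χ z * φ z)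
    (χ.contDiff.mul hφ) χ.hasCompactSupport.mul_right e
  rw [setIntegral_congr_fun h.isOpen.measurableSet (g := fun z => fderiv ℝ φ z e) fun z hz => by
    simp only [(hχ z (subset_closure hz)).fderiv_eq]] at h1
  rw [h1]
  refine Finset.sum_congr rfl fun F hF => ?_
  rw [setIntegral_congr_fun (h.isClosed_face hF).measurableSet fun x hx =>
    (hχ x (h.face_subset hF hx)).eq_of_nhds]

/-- The divergence theorem on a polytopal element. -/
theorem integral_divergence (h : IsPolytopal K 𝓕 ν p) {G : E d → E d} (hG : ContDiff ℝ 1 G) :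
    ∫ z in K, divergence G z
      = ∑ F ∈ 𝓕, ∫ x in F, ⟪G x, ν F⟫ ∂(Measure.euclideanHausdorffMeasure (d - 1)) := by
  have hGi : ∀ i, ContDiff ℝ 1 fun x => G x i := fun i => by fun_prop
  have hder : ∀ (i : Fin d) (z e : E d), (fderiv ℝ G z e) i = fderiv ℝ (fun x => G x i) z e := by
    intro i z e
    have h1 := ((EuclideanSpace.proj i : E d →L[ℝ] ℝ).hasFDerivAt
      (x := G z)).comp z (hG.differentiable one_ne_zero z).hasFDerivAt
    have h2 : fderiv ℝ (fun x => G x i) z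
        = (EuclideanSpace.proj i : E d →L[ℝ] ℝ).comp (fderiv ℝ G z) :=
      h1.fderiv
    rw [h2]
    rfl
  simp only [divergence, hder]
  rw [integral_finsetSum _ fun i _ => integrableOn_of_isBounded h.isBounded
    (((hGi i).continuous_fderiv one_ne_zero).clm_apply continuous_const)]
  simp only [fun i => h.integral_fderiv (hGi i)]
  rw [Finset.sum_comm]
  refine Finset.sum_congr rfl fun F hF => ?_
  simp only [← integral_const_mul]
  rw [← integral_finsetSum _ fun i _ => (h.integrableOn_face hF
    (hGi i).continuous.continuousOn).const_mul _]
  refine integral_congr_ae (Eventually.of_forall fun x => ?_)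
  simp [PiLp.inner_apply]

end IsPolytopal

/-! ### Traces through smooth extensions, and the product rule for the divergence. -/

theorem trace_eq_of_eqOn {d : ℕ} {K : Set (E d)} {w g : E d → E d} (hg : Continuous g)
    (hwg : EqOn w g K) {x : E d} (hx : x ∈ closure K) : trace K w x = g x := by
  have : (𝓝[K] x).NeBot := mem_closure_iff_nhdsWithin_neBot.1 hx
  refine Tendsto.limUnder_eq ?_
  exact (hg.continuousAt.mono_left nhdsWithin_le_nhds).congr'
    (eventually_nhdsWithin_of_forall fun y hy => (hwg hy).symm)

theorem fderiv_eq_of_eqOn {d : ℕ} {K : Set (E d)} (hK : IsOpen K) {w g : E d → E d}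
    (hwg : EqOn w g K) {x : E d} (hx : x ∈ K) : fderiv ℝ w x = fderiv ℝ g x :=
  (hwg.eventuallyEq_of_mem (hK.mem_nhds hx)).fderiv_eq

theorem divergence_eq_of_eqOn {d : ℕ} {K : Set (E d)} (hK : IsOpen K) {w g : E d → E d}
    (hwg : EqOn w g K) {x : E d} (hx : x ∈ K) : divergence w x = divergence g x := by
  simp only [divergence, fderiv_eq_of_eqOn hK hwg hx]

theorem divergence_smul {d : ℕ} {f : E d → ℝ} {B : E d → E d} {x : E d}
    (hf : DifferentiableAt ℝ f x) (hB : DifferentiableAt ℝ B x) :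
    divergence (fun y => f y • B y) x = fderiv ℝ f x (B x) + f x * divergence B x := by
  have h1 : B x = ∑ i : Fin d, B x i • EuclideanSpace.single i (1 : ℝ) := by
    conv_lhs => rw [← (EuclideanSpace.basisFun (Fin d) ℝ).sum_repr (B x)]
    simp
  have h2 : fderiv ℝ f x (B x)
      = ∑ i : Fin d, B x i * fderiv ℝ f x (EuclideanSpace.single i (1 : ℝ)) := by
    conv_lhs => rw [h1]
    simp
  rw [h2]
  simp only [divergence, fderiv_fun_smul hf hB, Finset.mul_sum, ← Finset.sum_add_distrib]
  refine Finset.sum_congr rfl fun i _ => ?_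
  simp
  ring

/-- The divergence theorem on a polytopal element for the product of a scalar and a vector field. -/
theorem IsPolytopal.integral_fderiv_add_mul_divergence {d : ℕ} {K : Set (E d)}
    {𝓕 : Finset (Set (E d))} {ν p : Set (E d) → E d} (h : IsPolytopal K 𝓕 ν p) {f : E d → ℝ}
    {B : E d → E d} (hf : ContDiff ℝ 1 f) (hB : ContDiff ℝ 1 B) :
    ∫ x in K, (fderiv ℝ f x (B x) + f x * divergence B x)
      = ∑ F ∈ 𝓕, ∫ x in F, f x * ⟪B x, ν F⟫ ∂(Measure.euclideanHausdorffMeasure (d - 1)) := by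
  have h1 := h.integral_divergence (G := fun x => f x • B x) (hf.smul hB)
  simp only [real_inner_smul_left] at h1
  rw [← h1]
  refine integral_congr_ae (Eventually.of_forall fun x => ?_)
  exact (divergence_smul (hf.differentiable one_ne_zero x) (hB.differentiable one_ne_zero x)).symm

/-! ### Elements and faces of the mesh. -/

namespace Mesh

variable {d : ℕ} {Ω : Set (E d)}

open Classical in
/-- The faces of the element `K`. -/
noncomputable def elementFaces (M : Mesh d Ω) (K : Set (E d)) : Finset (Set (E d)) :=
  M.faces.filter (· ⊆ frontier K)

open Classical in
/-- The unit normal on the face `F` pointing out of the element `K`. -/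
noncomputable def outwardNormal (M : Mesh d Ω) (K F : Set (E d)) : E d :=
  if K = M.plus F then M.normal F else -M.normal F

theorem mem_elementFaces (M : Mesh d Ω) {K F : Set (E d)} :
    F ∈ M.elementFaces K ↔ F ∈ M.faces ∧ F ⊆ frontier K := by
  simp [elementFaces]

theorem mem_interiorFaces (M : Mesh d Ω) {F : Set (E d)} :
    F ∈ M.interiorFaces ↔ F ∈ M.faces ∧ IsInteriorFace Ω F := by
  simp [interiorFaces]

theorem mem_elementFaces_minus (M : Mesh d Ω) {F : Set (E d)} (hF : F ∈ M.interiorFaces) :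
    F ∈ M.elementFaces (M.minus F) := by
  rw [mem_interiorFaces] at hF
  exact M.mem_elementFaces.2 ⟨hF.1, (M.minus_mem F hF.1 hF.2).2.2⟩

theorem minus_mem_elements (M : Mesh d Ω) {F : Set (E d)} (hF : F ∈ M.interiorFaces) :
    M.minus F ∈ M.elements := by
  rw [mem_interiorFaces] at hF
  exact (M.minus_mem F hF.1 hF.2).1

theorem outwardNormal_plus (M : Mesh d Ω) (F : Set (E d)) :
    M.outwardNormal (M.plus F) F = M.normal F :=
  if_pos rfl

theorem outwardNormal_minus (M : Mesh d Ω) {F : Set (E d)} (hF : F ∈ M.interiorFaces) :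
    M.outwardNormal (M.minus F) F = -M.normal F := by
  rw [mem_interiorFaces] at hF
  exact if_neg (M.minus_mem F hF.1 hF.2).2.1

/-- A face of `K` has `K` on its plus or minus side, so the sign choice in `outwardNormal` is right.
Any point of the face serves as base point of its hyperplane. -/
theorem isPolytopal (M : Mesh d Ω) (hΩ : Bornology.IsBounded Ω) {K : Set (E d)}
    (hK : K ∈ M.elements) :
    IsPolytopal K (M.elementFaces K) (M.outwardNormal K) fun F => Classical.epsilon (· ∈ F) := by
  have hnormal : ∀ F ∈ M.elementFaces K, IsOutwardNormal K F (M.outwardNormal K F) := by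
    intro F hFK
    obtain ⟨hF, hFK⟩ := M.mem_elementFaces.1 hFK
    rcases M.adjacent F hF K hK hFK with rfl | ⟨hi, rfl⟩
    · rw [M.outwardNormal_plus]
      exact M.normal_plus F hF
    · rw [M.outwardNormal_minus (M.mem_interiorFaces.2 ⟨hF, hi⟩)]
      exact M.normal_minus F hF hi
  refine ⟨M.isOpen_element K hK, hΩ.subset (M.element_subset K hK), ?_, ?_, ?_, hnormal, ?_⟩
  · conv_lhs => rw [M.frontier_element K hK]
    ext x
    simp [mem_elementFaces]
  · exact fun F hF => M.isFlatFace F (M.mem_elementFaces.1 hF).1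
  · exact fun F hF G hG => M.disjoint_faces F (M.mem_elementFaces.1 hF).1 G
      (M.mem_elementFaces.1 hG).1
  · exact fun F hF x hx => (hnormal F hF).2.1 x hx _ (Classical.epsilon_spec ⟨x, hx⟩)

-- Regrouping by faces: an interior face is counted from its two sides, a boundary face once.
open Classical in
theorem sum_elementFaces (M : Mesh d Ω) (a : Set (E d) → Set (E d) → ℝ) :
    ∑ K ∈ M.elements, ∑ F ∈ M.elementFaces K, a K F
      = ∑ F ∈ M.faces, (a (M.plus F) F + if IsInteriorFace Ω F then a (M.minus F) F else 0) := by
  rw [Finset.sum_comm' (t' := M.faces) (s' := fun F => M.elements.filter (F ⊆ frontier ·))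
    (fun K F => by simp only [mem_elementFaces, Finset.mem_filter]; tauto)]
  refine Finset.sum_congr rfl fun F hF => ?_
  obtain ⟨hp1, hp2⟩ := M.plus_mem F hF
  split_ifs with hi
  · obtain ⟨hm1, hm2, hm3⟩ := M.minus_mem F hF hi
    rw [← Finset.sum_pair (f := fun K => a K F) hm2.symm]
    refine Finset.sum_congr ?_ fun _ _ => rfl
    ext K
    simp only [Finset.mem_filter, Finset.mem_insert, Finset.mem_singleton]
    constructor
    · rintro ⟨hK, hFK⟩
      exact (M.adjacent F hF K hK hFK).imp id And.right
    · rintro (rfl | rfl)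
      exacts [⟨hp1, hp2⟩, ⟨hm1, hm3⟩]
  · rw [add_zero, ← Finset.sum_singleton (fun K => a K F)]
    refine Finset.sum_congr ?_ fun _ _ => rfl
    ext K
    simp only [Finset.mem_filter, Finset.mem_singleton]
    constructor
    · rintro ⟨hK, hFK⟩
      exact (M.adjacent F hF K hK hFK).resolve_right fun h => hi h.1
    · rintro rfl
      exact ⟨hp1, hp2⟩

theorem ae_notMem_intrinsicFrontier (M : Mesh d Ω) {F : Set (E d)} (hF : F ∈ M.faces) :
    ∀ᵐ x ∂(Measure.euclideanHausdorffMeasure (d - 1) : Measure (E d)),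
      x ∉ intrinsicFrontier ℝ F := by
  obtain ⟨hn, hperp, -⟩ := M.normal_plus F hF
  exact measure_eq_zero_iff_ae_notMem.1 (euclideanHausdorffMeasure_intrinsicFrontier hn
    (M.isFlatFace F hF).convex (p := Classical.epsilon (· ∈ F))
    fun x hx => hperp x hx _ (Classical.epsilon_spec ⟨x, hx⟩))

/-- Distinct faces meet only in their relative boundaries, which have surface measure zero. -/
theorem ae_notMem_other_face (M : Mesh d Ω) {F : Set (E d)} (hF : F ∈ M.faces) :
    ∀ᵐ x ∂(Measure.euclideanHausdorffMeasure (d - 1) : Measure (E d)),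
      x ∈ F → ∀ G ∈ M.faces, G ≠ F → x ∉ G := by
  have h1 : ∀ᵐ x ∂(Measure.euclideanHausdorffMeasure (d - 1) : Measure (E d)),
      ∀ G ∈ M.faces, x ∉ intrinsicFrontier ℝ G :=
    (Finset.eventually_all _).2 fun G hG => M.ae_notMem_intrinsicFrontier hG
  filter_upwards [h1] with x hx hxF G hG hGF hxG
  exact (mem_intrinsicFrontier_of_mem_inter (M.isFlatFace G hG).isCompact.isClosed
    (M.isFlatFace F hF).isCompact.isClosed (M.disjoint_faces G hG F hF hGF) hxG hxF).elim
      (hx G hG) (hx F hF)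

theorem integrableOn_face (M : Mesh d Ω) {F : Set (E d)} (hF : F ∈ M.faces) {f : E d → ℝ}
    (hf : ContinuousOn f F) :
    IntegrableOn f F (Measure.euclideanHausdorffMeasure (d - 1)) := by
  obtain ⟨hn, hperp, -⟩ := M.normal_plus F hF
  have hc := (M.isFlatFace F hF).isCompact
  exact integrableOn_of_isCompact_of_lt_top hc hc.isClosed.measurableSet
    (euclideanHausdorffMeasure_lt_top_of_isCompact hn hc (p := Classical.epsilon (· ∈ F))
      fun x hx => hperp x hx _ (Classical.epsilon_spec ⟨x, hx⟩)) hf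

theorem setIntegral_eq_sum (M : Mesh d Ω) (hΩb : Bornology.IsBounded Ω) {f : E d → ℝ}
    (hf : ∀ K ∈ M.elements, IntegrableOn f K) :
    ∫ x in Ω, f x = ∑ K ∈ M.elements, ∫ x in K, f x := by
  have hfr : ∀ᵐ x : E d, ∀ K ∈ M.elements, x ∉ frontier K :=
    (Finset.eventually_all _).2 fun K hK =>
      measure_eq_zero_iff_ae_notMem.1 (M.isPolytopal hΩb hK).volume_frontier
  have h1 : Ω =ᵐ[volume] ⋃ K ∈ M.elements, K := by
    filter_upwards [hfr] with x hx
    refine propext ⟨fun hxΩ => ?_, fun hxK => ?_⟩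
    · obtain ⟨K, hK, hxK⟩ := mem_iUnion₂.1 (M.cover.subset (subset_closure hxΩ))
      refine mem_iUnion₂.2 ⟨K, hK, ?_⟩
      by_contra hxK'
      exact hx K hK ⟨hxK, fun hi => hxK' (interior_subset hi)⟩
    · obtain ⟨K, hK, hxK⟩ := mem_iUnion₂.1 hxK
      exact M.element_subset K hK hxK
  rw [setIntegral_congr_set h1, integral_biUnion_finset _
    (fun K hK => (M.isOpen_element K hK).measurableSet)
    (fun K hK L hL hKL => M.disjoint_elements K hK L hL hKL) hf]

/-! ### Normal continuity of piecewise smooth fields in `H_0(div)`. -/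

/-- The weak divergence of a piecewise `C¹` field in `H_0(div)` is its piecewise divergence. -/
theorem ae_eq_divergence (M : Mesh d Ω) (hΩ : IsOpen Ω) (hΩb : Bornology.IsBounded Ω)
    {β : E d → E d} {g : E d → ℝ} (hg : MemLp g 2 (volume.restrict Ω))
    (hβ : NormalTraceZero Ω β g) {K : Set (E d)} (hK : K ∈ M.elements) {B : E d → E d}
    (hB : ContDiff ℝ 1 B) (hβB : EqOn β B K) :
    ∀ᵐ x : E d, x ∈ K → g x = divergence B x := by
  have hKo := M.isOpen_element K hK
  have hKb := hΩb.subset (M.element_subset K hK)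
  have hfin : IsFiniteMeasure (volume.restrict Ω) := ⟨by simpa using hΩb.measure_lt_top⟩
  have hgK : IntegrableOn g K :=
    IntegrableOn.mono_set (hg.integrable one_le_two) (M.element_subset K hK)
  have hdiv := integrableOn_of_isBounded hKb (continuous_divergence hB)
  have h1 : ∀ᵐ x : E d, x ∈ K → g x - divergence B x = 0 := by
    refine hKo.ae_eq_zero_of_integral_contDiff_smul_eq_zero
      (hgK.sub hdiv).locallyIntegrableOn fun φ hφ hφc hφK => ?_
    have hφ1 : ContDiff ℝ 1 φ := hφ.of_le (by exact_mod_cast le_top)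
    have hφ0 : ∀ x ∉ K, φ x = 0 := fun x hx => image_eq_zero_of_notMem_tsupport fun h => hx (hφK h)
    have h2 := hβ φ hφ hφc
    rw [setIntegral_eq_of_subset_of_forall_sdiff_eq_zero hΩ.measurableSet (M.element_subset K hK)
      (fun x hx => by
        simp [hφ0 x hx.2, fderiv_of_notMem_tsupport (𝕜 := ℝ) fun h => hx.2 (hφK h)])] at h2
    -- The test function is supported in the open set `K`, so it vanishes on the faces and the
    -- boundary terms drop out.
    have h3 := (M.isPolytopal hΩb hK).integral_fderiv_add_mul_divergence hφ1 hB
    rw [Finset.sum_eq_zero fun F hF => by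
      rw [setIntegral_eq_zero_of_forall_eq_zero fun x hx => ?_]
      rw [hφ0 x, zero_mul]
      have := (M.mem_elementFaces.1 hF).2 hx
      rw [hKo.frontier_eq] at this
      exact this.2] at h3
    have hd : Continuous fun x => fderiv ℝ φ x (B x) :=
      (hφ1.continuous_fderiv one_ne_zero).clm_apply hB.continuous
    obtain ⟨C, hC⟩ := hφc.exists_bound_of_continuous hφ.continuous
    have hi1 := integrableOn_of_isBounded hKb hd
    have hi2 : IntegrableOn (fun x => φ x * divergence B x) K :=
      integrableOn_of_isBounded hKb (hφ.continuous.mul (continuous_divergence hB))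
    have hi3 : IntegrableOn (fun x => g x * φ x) K :=
      hgK.mul_bdd hφ.continuous.aestronglyMeasurable (Eventually.of_forall hC)
    have h4 : ∫ x in K, (fderiv ℝ φ x (B x) + g x * φ x) = 0 := by
      rw [← h2]
      refine setIntegral_congr_fun hKo.measurableSet fun x hx => ?_
      simp only [hβB hx]
    rw [integral_add hi1 hi3] at h4
    rw [integral_add hi1 hi2] at h3
    rw [← setIntegral_eq_integral_of_forall_compl_eq_zero (s := K) fun x hx => by simp [hφ0 x hx]]
    have h5 : ∀ x, φ x • (g x - divergence B x) = g x * φ x - φ x * divergence B x := fun x => by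
      rw [smul_eq_mul]; ring
    simp only [h5]
    rw [integral_sub hi3 hi2]
    linarith
  filter_upwards [h1] with x hx hxK using sub_eq_zero.1 (hx hxK)

open Classical in
/-- The normal component of a piecewise `C¹` field in `H_0(div)` is continuous across the interior
faces and vanishes on the boundary faces. -/
theorem ae_normal_jump_eq_zero (M : Mesh d Ω) (hΩ : IsOpen Ω) (hΩb : Bornology.IsBounded Ω)
    {β : E d → E d} (hβ : MemH0Div Ω β) {B : Set (E d) → E d → E d}
    (hB : ∀ K ∈ M.elements, ContDiff ℝ 1 (B K) ∧ EqOn β (B K) K) {F : Set (E d)}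
    (hF : F ∈ M.faces) :
    ∀ᵐ x ∂(Measure.euclideanHausdorffMeasure (d - 1) : Measure (E d)), x ∈ F →
      ⟪B (M.plus F) x, M.normal F⟫
        - (if IsInteriorFace Ω F then ⟪B (M.minus F) x, M.normal F⟫ else 0) = 0 := by
  obtain ⟨-, g, hg, -, hβg⟩ := hβ
  let D : Set (E d) → E d → ℝ := fun F x => ⟪B (M.plus F) x, M.normal F⟫
    - (if IsInteriorFace Ω F then ⟪B (M.minus F) x, M.normal F⟫ else 0)
  have hDc : ∀ F ∈ M.faces, Continuous (D F) := by
    intro F hF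
    have h1 := (hB _ (M.plus_mem F hF).1).1.continuous
    by_cases hi : IsInteriorFace Ω F
    · have h2 := (hB _ (M.minus_mem F hF hi).1).1.continuous
      simp only [D, hi, if_true]
      fun_prop
    · simp only [D, hi, if_false]
      fun_prop
  have hDi : ∀ F ∈ M.faces, Integrable (F.indicator (D F))
      (Measure.euclideanHausdorffMeasure (d - 1)) := fun F hF =>
    (integrable_indicator_iff (M.isFlatFace F hF).isCompact.isClosed.measurableSet).2
      (M.integrableOn_face hF (hDc F hF).continuousOn)
  -- All faces are treated at once: `φ` is an arbitrary test function on `ℝ^d`, and elementwise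
  -- integration by parts leaves the integral of `φ` against the sum of the face jumps.
  have key : ∀ᵐ x ∂(Measure.euclideanHausdorffMeasure (d - 1) : Measure (E d)),
      ∑ F ∈ M.faces, F.indicator (D F) x = 0 := by
    refine ae_eq_zero_of_integral_contDiff_smul_eq_zero
      (integrable_finsetSum _ hDi).locallyIntegrable fun φ hφ hφc => ?_
    have hφ1 : ContDiff ℝ 1 φ := hφ.of_le (by exact_mod_cast le_top)
    have hcongr : ∀ K ∈ M.elements, ∀ᵐ x : E d, x ∈ K → fderiv ℝ φ x (β x) + g x * φ x
        = fderiv ℝ φ x (B K x) + φ x * divergence (B K) x := by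
      intro K hK
      filter_upwards [M.ae_eq_divergence hΩ hΩb hg hβg hK (hB K hK).1 (hB K hK).2] with x hx hxK
      rw [hx hxK, (hB K hK).2 hxK]
      ring
    have hint : ∀ K ∈ M.elements, IntegrableOn (fun x => fderiv ℝ φ x (β x) + g x * φ x) K := by
      intro K hK
      have hBK := (hB K hK).1
      have hc : Continuous fun x => fderiv ℝ φ x (B K x) + φ x * divergence (B K) x :=
        ((hφ1.continuous_fderiv one_ne_zero).clm_apply hBK.continuous).add
          (hφ.continuous.mul (continuous_divergence hBK))
      refine (integrableOn_of_isBounded (hΩb.subset (M.element_subset K hK)) hc).congr ?_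
      filter_upwards [(ae_restrict_iff' (M.isOpen_element K hK).measurableSet).2 (hcongr K hK)]
        with x hx using hx.symm
    have h1 := hβg φ hφ hφc
    rw [M.setIntegral_eq_sum hΩb hint, Finset.sum_congr rfl fun K hK => by
      rw [setIntegral_congr_ae (M.isOpen_element K hK).measurableSet (hcongr K hK),
        (M.isPolytopal hΩb hK).integral_fderiv_add_mul_divergence hφ1 (hB K hK).1],
      M.sum_elementFaces (fun K F => ∫ x in F, φ x * ⟪B K x, M.outwardNormal K F⟫
        ∂(Measure.euclideanHausdorffMeasure (d - 1)))] at h1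
    have h2 : ∀ x, φ x • ∑ F ∈ M.faces, F.indicator (D F) x
        = ∑ F ∈ M.faces, F.indicator (fun x => φ x * D F x) x := by
      intro x
      rw [smul_eq_mul, Finset.mul_sum]
      refine Finset.sum_congr rfl fun F _ => ?_
      by_cases hx : x ∈ F <;> simp [hx]
    have hi : ∀ F ∈ M.faces, Integrable (F.indicator fun x => φ x * D F x)
        (Measure.euclideanHausdorffMeasure (d - 1)) := fun F hF =>
      (integrable_indicator_iff (M.isFlatFace F hF).isCompact.isClosed.measurableSet).2
        (M.integrableOn_face hF (hφ.continuous.mul (hDc F hF)).continuousOn)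
    simp only [h2]
    rw [integral_finsetSum _ hi, ← h1]
    refine Finset.sum_congr rfl fun F hF => ?_
    rw [integral_indicator (M.isFlatFace F hF).isCompact.isClosed.measurableSet,
      M.outwardNormal_plus]
    have hp := (hB _ (M.plus_mem F hF).1).1.continuous
    by_cases hF' : IsInteriorFace Ω F
    · have hFi := M.mem_interiorFaces.2 ⟨hF, hF'⟩
      have hm := (hB _ (M.minus_mem_elements hFi)).1.continuous
      have hφ' := hφ.continuous
      rw [if_pos hF', M.outwardNormal_minus hFi, ← integral_add
        (M.integrableOn_face hF (by fun_prop)) (M.integrableOn_face hF (by fun_prop))]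
      refine integral_congr_ae (Eventually.of_forall fun x => ?_)
      simp only [D, if_pos hF', inner_neg_right]
      ring
    · rw [if_neg hF', add_zero]
      simp [D, hF']
  -- Almost every point of `F` lies on no other face, so the sum reduces to the term of `F`.
  filter_upwards [key, M.ae_notMem_other_face hF] with x hx hother hxF
  rw [Finset.sum_eq_single_of_mem F hF fun G hG hGF =>
    indicator_of_notMem (hother hxF G hG hGF) _, indicator_of_mem hxF] at hx
  exact hx

end Mesh

/-! ### The energy identity. -/

namespace Mesh

variable {d : ℕ} {Ω : Set (E d)}

theorem face_subset_closure_plus (M : Mesh d Ω) {F : Set (E d)} (hF : F ∈ M.faces) :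
    F ⊆ closure (M.plus F) :=
  (M.plus_mem F hF).2.trans frontier_subset_closure

theorem face_subset_closure_minus (M : Mesh d Ω) {F : Set (E d)} (hF : F ∈ M.interiorFaces) :
    F ⊆ closure (M.minus F) :=
  (M.mem_elementFaces.1 (M.mem_elementFaces_minus hF)).2.trans frontier_subset_closure

/-- The volume terms of the convective form on one element are boundary terms. -/
theorem element_integral (M : Mesh d Ω) (hΩb : Bornology.IsBounded Ω) {K : Set (E d)}
    (hK : K ∈ M.elements) {β w B V : E d → E d} (hB : ContDiff ℝ 1 B) (hβ : EqOn β B K)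
    (hV : ContDiff ℝ 1 V) (hw : EqOn w V K) :
    (∫ x in K, ⟪fderiv ℝ w x (β x), w x⟫) + (1 / 2) * ∫ x in K, ⟪divergence β x • w x, w x⟫
      = ∑ F ∈ M.elementFaces K, ∫ x in F, (1 / 2) * (‖V x‖ ^ 2 * ⟪B x, M.outwardNormal K F⟫)
        ∂(Measure.euclideanHausdorffMeasure (d - 1)) := by
  have hKo := M.isOpen_element K hK
  have hKb := hΩb.subset (M.element_subset K hK)
  have hsq : ContDiff ℝ 1 fun x => ‖V x‖ ^ 2 := hV.norm_sq ℝ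
  have h1 : ∫ x in K, ⟪fderiv ℝ w x (β x), w x⟫ = ∫ x in K, ⟪fderiv ℝ V x (B x), V x⟫ :=
    setIntegral_congr_fun hKo.measurableSet fun x hx => by
      simp only [fderiv_eq_of_eqOn hKo hw hx, hβ hx, hw hx]
  have h2 : ∫ x in K, ⟪divergence β x • w x, w x⟫ = ∫ x in K, ‖V x‖ ^ 2 * divergence B x :=
    setIntegral_congr_fun hKo.measurableSet fun x hx => by
      simp only [divergence_eq_of_eqOn hKo hβ hx, hw hx, real_inner_smul_left,
        real_inner_self_eq_norm_sq]
      ring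
  have hc1 : Continuous fun x => ⟪fderiv ℝ V x (B x), V x⟫ :=
    ((hV.continuous_fderiv one_ne_zero).clm_apply hB.continuous).inner hV.continuous
  have hc2 : Continuous fun x => ‖V x‖ ^ 2 * divergence B x :=
    hsq.continuous.mul (continuous_divergence hB)
  have h3 := (M.isPolytopal hΩb hK).integral_fderiv_add_mul_divergence hsq hB
  -- This factor `2` matches the `½` before the divergence term: the volume terms are half of the
  -- divergence of `|V|² B`.
  have h4 : ∀ x, fderiv ℝ (fun x => ‖V x‖ ^ 2) x (B x) = 2 * ⟪fderiv ℝ V x (B x), V x⟫ := by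
    intro x
    rw [((hV.differentiable one_ne_zero x).hasFDerivAt.norm_sq).fderiv]
    simp [real_inner_comm]
  simp only [h4] at h3
  rw [integral_add ((integrableOn_of_isBounded hKb hc1).const_mul 2)
    (integrableOn_of_isBounded hKb hc2), integral_const_mul] at h3
  simp only [integral_const_mul, ← Finset.mul_sum]
  rw [h1, h2, ← h3]
  ring

theorem convForm_self (M : Mesh d Ω) (hΩ : IsOpen Ω) (hΩb : Bornology.IsBounded Ω) (ζ : ℝ)
    {β w : E d → E d} (hβ : MemH0Div Ω β) (hβ1 : IsPiecewiseC1 M β) (hw1 : IsPiecewiseC1 M w) :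
    M.convForm ζ β w w = ζ * M.upwind β w w := by
  classical
  choose! B hB using hβ1
  choose! V hV using hw1
  have hvol : (∑ K ∈ M.elements, ∫ x in K, ⟪fderiv ℝ w x (β x), w x⟫)
      + (1 / 2) * (∑ K ∈ M.elements, ∫ x in K, ⟪divergence β x • w x, w x⟫)
      = ∑ F ∈ M.interiorFaces, ∫ x in F, ⟪M.normalComp F β x • M.jump F w x, M.avg F w x⟫
          ∂(Measure.euclideanHausdorffMeasure (d - 1)) := by
    rw [Finset.mul_sum, ← Finset.sum_add_distrib, Finset.sum_congr rfl fun K hK =>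
      M.element_integral hΩb hK (hB K hK).1 (hB K hK).2 (hV K hK).1 (hV K hK).2,
      M.sum_elementFaces (fun K F => ∫ x in F, (1 / 2) * (‖V K x‖ ^ 2 *
        ⟪B K x, M.outwardNormal K F⟫) ∂(Measure.euclideanHausdorffMeasure (d - 1))),
      interiorFaces, Finset.sum_filter]
    refine Finset.sum_congr rfl fun F hF => ?_
    have hFm := (M.isFlatFace F hF).isCompact.isClosed.measurableSet
    have hp := (M.plus_mem F hF).1
    have hBp := (hB _ hp).1.continuous
    have hVp := (hV _ hp).1.continuous
    have hflux := M.ae_normal_jump_eq_zero hΩ hΩb hβ hB hF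
    rw [M.outwardNormal_plus]
    split_ifs with hi
    · have hFi := M.mem_interiorFaces.2 ⟨hF, hi⟩
      have hm := M.minus_mem_elements hFi
      have hBm := (hB _ hm).1.continuous
      have hVm := (hV _ hm).1.continuous
      rw [M.outwardNormal_minus hFi, ← integral_add
        (M.integrableOn_face hF (by fun_prop)) (M.integrableOn_face hF (by fun_prop))]
      refine setIntegral_congr_ae hFm ?_
      filter_upwards [hflux] with x hx hxF
      have hx' := hx hxF
      rw [if_pos hi, sub_eq_zero] at hx'
      have hxp := M.face_subset_closure_plus hF hxF
      have hxm := M.face_subset_closure_minus hFi hxF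
      -- With the flux from both sides written from the plus side, what remains is `⟪V₊ - V₋, V₊ +
      -- V₋⟫ = |V₊|² - |V₋|²`.
      rw [normalComp, jump, avg, trace_eq_of_eqOn hBp (hB _ hp).2 hxp,
        trace_eq_of_eqOn hVp (hV _ hp).2 hxp, trace_eq_of_eqOn hVm (hV _ hm).2 hxm,
        inner_neg_right, ← hx', real_inner_smul_left, real_inner_smul_right, inner_sub_left,
        inner_add_right, inner_add_right, real_inner_self_eq_norm_sq, real_inner_self_eq_norm_sq,
        real_inner_comm (V (M.plus F) x) (V (M.minus F) x)]
      ring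
    -- On a boundary face the normal flux vanishes almost everywhere, and the integral with it.
    · rw [add_zero]
      rw [setIntegral_congr_ae (g := fun _ => (0 : ℝ)) hFm, integral_zero]
      filter_upwards [hflux] with x hx hxF
      have hx' := hx hxF
      rw [if_neg hi, sub_zero] at hx'
      simp [hx']
  rw [convForm, hvol]
  ring

/-! ### The upwind form as a semi-inner product. -/

theorem upwind_self_nonneg (M : Mesh d Ω) (β w : E d → E d) : 0 ≤ M.upwind β w w :=
  Finset.sum_nonneg fun _ _ => integral_nonneg fun _ =>
    mul_nonneg (abs_nonneg _) real_inner_self_nonneg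

theorem upwind_comm (M : Mesh d Ω) (β v w : E d → E d) : M.upwind β v w = M.upwind β w v := by
  simp only [upwind, real_inner_comm]

theorem exists_continuous_jump (M : Mesh d Ω) {w : E d → E d} (hw : IsPiecewiseC1 M w)
    {F : Set (E d)} (hF : F ∈ M.interiorFaces) :
    ∃ P N : E d → E d, (Continuous P ∧ EqOn w P (M.plus F)) ∧
      (Continuous N ∧ EqOn w N (M.minus F)) ∧ EqOn (M.jump F w) (P - N) F := by
  have hF' := (M.mem_interiorFaces.1 hF).1
  obtain ⟨P, hP, hwP⟩ := hw _ (M.plus_mem F hF').1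
  obtain ⟨N, hN, hwN⟩ := hw _ (M.minus_mem_elements hF)
  refine ⟨P, N, ⟨hP.continuous, hwP⟩, ⟨hN.continuous, hwN⟩, fun x hx => ?_⟩
  rw [jump, trace_eq_of_eqOn hP.continuous hwP (M.face_subset_closure_plus hF' hx),
    trace_eq_of_eqOn hN.continuous hwN (M.face_subset_closure_minus hF hx)]
  rfl

theorem continuousOn_jump (M : Mesh d Ω) {w : E d → E d} (hw : IsPiecewiseC1 M w)
    {F : Set (E d)} (hF : F ∈ M.interiorFaces) : ContinuousOn (M.jump F w) F := by
  obtain ⟨P, N, ⟨hP, -⟩, ⟨hN, -⟩, h⟩ := M.exists_continuous_jump hw hF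
  exact (hP.sub hN).continuousOn.congr h

theorem continuousOn_normalComp (M : Mesh d Ω) {β : E d → E d} (hβ : IsPiecewiseC1 M β)
    {F : Set (E d)} (hF : F ∈ M.faces) : ContinuousOn (M.normalComp F β) F := by
  obtain ⟨P, hP, hβP⟩ := hβ _ (M.plus_mem F hF).1
  have hc : Continuous fun x => ⟪P x, M.normal F⟫ := hP.continuous.inner continuous_const
  refine hc.continuousOn.congr fun x hx => ?_
  rw [normalComp, trace_eq_of_eqOn hP.continuous hβP (M.face_subset_closure_plus hF hx)]

/-- `limUnder` is additive only where the limits exist; the continuous extensions from both sides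
guarantee this. -/
theorem jump_add (M : Mesh d Ω) {v w : E d → E d} (hv : IsPiecewiseC1 M v)
    (hw : IsPiecewiseC1 M w) {F : Set (E d)} (hF : F ∈ M.interiorFaces) {x : E d} (hx : x ∈ F) :
    M.jump F (v + w) x = M.jump F v x + M.jump F w x := by
  have hF' := (M.mem_interiorFaces.1 hF).1
  obtain ⟨P, N, ⟨hP, hvP⟩, ⟨hN, hvN⟩, h⟩ := M.exists_continuous_jump hv hF
  obtain ⟨P', N', ⟨hP', hwP'⟩, ⟨hN', hwN'⟩, h'⟩ := M.exists_continuous_jump hw hF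
  rw [h hx, h' hx, jump, trace_eq_of_eqOn (w := v + w) (hP.add hP') (fun y hy => congrArg₂ (· + ·) (hvP hy) (hwP' hy))
    (M.face_subset_closure_plus hF' hx), trace_eq_of_eqOn (w := v + w) (hN.add hN')
    (fun y hy => congrArg₂ (· + ·) (hvN hy) (hwN' hy)) (M.face_subset_closure_minus hF hx)]
  change P x + P' x - (N x + N' x) = P x - N x + (P' x - N' x)
  abel

theorem jump_smul (M : Mesh d Ω) {v : E d → E d} (hv : IsPiecewiseC1 M v) (c : ℝ)
    {F : Set (E d)} (hF : F ∈ M.interiorFaces) {x : E d} (hx : x ∈ F) :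
    M.jump F (c • v) x = c • M.jump F v x := by
  have hF' := (M.mem_interiorFaces.1 hF).1
  obtain ⟨P, N, ⟨hP, hvP⟩, ⟨hN, hvN⟩, h⟩ := M.exists_continuous_jump hv hF
  rw [h hx, jump, trace_eq_of_eqOn (w := c • v) (hP.const_smul c) (fun y hy => congrArg (c • ·) (hvP hy))
    (M.face_subset_closure_plus hF' hx), trace_eq_of_eqOn (w := c • v) (hN.const_smul c)
    (fun y hy => congrArg (c • ·) (hvN hy)) (M.face_subset_closure_minus hF hx)]
  exact (smul_sub c (P x) (N x)).symm

theorem upwind_add_left (M : Mesh d Ω) {β u v w : E d → E d} (hβ : IsPiecewiseC1 M β)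
    (hu : IsPiecewiseC1 M u) (hv : IsPiecewiseC1 M v) (hw : IsPiecewiseC1 M w) :
    M.upwind β (u + v) w = M.upwind β u w + M.upwind β v w := by
  have hc : ∀ F ∈ M.interiorFaces, ∀ v : E d → E d, IsPiecewiseC1 M v →
      IntegrableOn (fun x => |M.normalComp F β x| * ⟪M.jump F v x, M.jump F w x⟫) F
        (Measure.euclideanHausdorffMeasure (d - 1)) := by
    intro F hF v hv
    have hF' := (M.mem_interiorFaces.1 hF).1
    exact M.integrableOn_face hF' ((M.continuousOn_normalComp hβ hF').abs.mul
      ((M.continuousOn_jump hv hF).inner (M.continuousOn_jump hw hF)))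
  rw [upwind, upwind, upwind, ← Finset.sum_add_distrib]
  refine Finset.sum_congr rfl fun F hF => ?_
  rw [← integral_add (hc F hF u hu) (hc F hF v hv)]
  refine setIntegral_congr_fun (M.isFlatFace F
    (M.mem_interiorFaces.1 hF).1).isCompact.isClosed.measurableSet fun x hx => ?_
  simp only [M.jump_add hu hv hF hx, inner_add_left, mul_add]

theorem upwind_smul_left (M : Mesh d Ω) (β : E d → E d) {v : E d → E d} (w : E d → E d)
    (hv : IsPiecewiseC1 M v) (c : ℝ) : M.upwind β (c • v) w = c * M.upwind β v w := by
  rw [upwind, upwind, Finset.mul_sum]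
  refine Finset.sum_congr rfl fun F hF => ?_
  rw [← integral_const_mul]
  refine setIntegral_congr_fun (M.isFlatFace F
    (M.mem_interiorFaces.1 hF).1).isCompact.isClosed.measurableSet fun x hx => ?_
  simp only [M.jump_smul hv c hF hx, real_inner_smul_left]
  ring

/-- The scaled upwind form is a semi-inner product on spaces of piecewise `C¹` fields. -/
noncomputable abbrev upwindCore (M : Mesh d Ω) (W : Submodule ℝ (E d → E d))
    (hW : ∀ w ∈ W, IsPiecewiseC1 M w) {ζ : ℝ} (hζ : 0 ≤ ζ) {β : E d → E d}
    (hβ : IsPiecewiseC1 M β) : PreInnerProductSpace.Core ℝ W where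
  inner v w := ζ * M.upwind β v w
  conj_inner_symm v w := by simp [M.upwind_comm β w v]
  re_inner_nonneg w := mul_nonneg hζ (M.upwind_self_nonneg β w)
  add_left u v w := by
    simp only [Submodule.coe_add]
    rw [M.upwind_add_left hβ (hW _ u.2) (hW _ v.2) (hW _ w.2), mul_add]
  smul_left v w c := by
    simp only [Submodule.coe_smul, conj_trivial]
    rw [M.upwind_smul_left β w (hW _ v.2)]
    ring

/-- The triangle inequality is the Cauchy–Schwarz inequality for the semi-inner product
`upwindCore`, whose associated norm is by definition the square root of its diagonal. -/
theorem exists_seminorm_eq_convSeminorm (M : Mesh d Ω) (W : Submodule ℝ (E d → E d))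
    (hW : ∀ w ∈ W, IsPiecewiseC1 M w) {ζ : ℝ} (hζ : 0 ≤ ζ) {β : E d → E d}
    (hβ : IsPiecewiseC1 M β) : ∃ p : Seminorm ℝ W, ∀ w : W, p w = M.convSeminorm ζ β w := by
  let c := M.upwindCore W hW hζ hβ
  exact ⟨@normSeminorm ℝ W _ (InnerProductSpace.Core.toSeminormedAddCommGroup (c := c))
    (InnerProductSpace.Core.toNormedSpace (c := c)), fun w => rfl⟩

end Mesh

end MixedFE
theorem mainTheorem4 {d : ℕ} (hd : d = 2 ∨ d = 3) {Ω : Set (MixedFE.E d)}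
    (hΩ : IsOpen Ω) (hΩb : Bornology.IsBounded Ω) (M : MixedFE.Mesh d Ω)
    (W : Submodule ℝ (MixedFE.E d → MixedFE.E d))
    (hW : ∀ w ∈ W, MixedFE.MemH0Div Ω w ∧ MixedFE.IsPiecewiseC1 M w)
    (ζ : ℝ) (hζ : 0 ≤ ζ) :
    (∀ β ∈ W, ∀ w ∈ W,
      M.convForm ζ β w w = ζ * M.upwind β w w ∧
      M.convForm ζ β w w = (M.convSeminorm ζ β w) ^ 2) ∧
    (∀ β ∈ W, ∃ p : Seminorm ℝ W, ∀ w : W, p w = M.convSeminorm ζ β w) := by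
  have key : ∀ β ∈ W, ∀ w ∈ W, M.convForm ζ β w w = ζ * M.upwind β w w := fun β hβ w hw =>
    M.convForm_self hΩ hΩb ζ (hW β hβ).1 (hW β hβ).2 (hW w hw).2
  refine ⟨fun β hβ w hw => ⟨key β hβ w hw, ?_⟩, fun β hβ =>
    M.exists_seminorm_eq_convSeminorm W (fun w hw => (hW w hw).2) hζ (hW β hβ).2⟩
  rw [key β hβ w hw, MixedFE.Mesh.convSeminorm,
    Real.sq_sqrt (mul_nonneg hζ (M.upwind_self_nonneg β w))]
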